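/- **Setting.** Let $V\in C^\infty(\mathbb R)$ with $\mathrm e^{-V}\in L^1(\mathbb R)$, and put $Z=\int_{\mathbb R}\mathrm e^{-V}$ and $\mu=Z^{-1}\mathrm e^{-V}\,\mathrm dx$. Let $J\ge 1$ and $\lambda_1,\dots,\lambda_J>0$. Let $f_1,\dots,f_J\in C^\infty(\mathbb R)\cap L^1(\mu)$, none of which is $\mu$-almost everywhere constant. For an observable $f$ write $I_f=\int f\,\mathrm d\mu$, and write $I_j=I_{f_j}$. For $U\colon\mathbb R\to\mathbb R$ let $Z[U]=\int_{\mathbb R}\mathrm e^{-V-U}$ and $\mu_U=Z[U]^{-1}\mathrm e^{-V-U}\,\mathrm dx$. **Admissible potentials.** Let $\mathfrak U_0$ be the set of $U\in C^\infty(\mathbb R)$ such that: 1. $\mathrm e^{-V-U}\in L^1(\mathbb R)$. 2. $\mu_U$ satisfies a Poincaré inequality: there is $R>0$ with $\|\varphi\|_{L^2(\mu_U)}^2\le R^{-1}\|\varphi'\|_{L^2(\mu_U)}^2$ for all $\varphi\in H^1(\mu_U)$ with $\int\varphi\,\mathrm d\mu_U=0$. 3. $(f_j-I_j)\,\mathrm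 e^U\in L^2(\mu_U)$ for $j=1,\dots,J$. 4. For every $x_0\in\mathbb R$, the equation $\mathrm dX_t=-(V+U)'(X_t)\,\mathrm dt+\sqrt2\,\mathrm dW_t$ with $X_0=x_0$ has a unique strong solution, global in time. **Asymptotic variance.** For an observable $f$ in the linear span of $f_1,\dots,f_J$ and $U\in\mathfrak U_0$, let $\phi_U\in H^1(\mu_U)$ be the unique distributional solution of $-\mathrm e^{V+U}(\mathrm e^{-V-U}\phi_U')'=(f-I_f)\,\mathrm e^U$ with $\int\phi_U\,\mathrm d\mu_U=0$. Define $$\sigma_f^2[U]=\frac{2Z[U]^2}{Z^2}\int_{\mathbb R}|\phi_U'|^2\,\mathrm d\mu_U .$$ Let $\sigma^2[U]=\mathbb E\bigl[\sigma^2_{f}[U]\bigr]$ for the random observable $f=\sum_{j=1}^J\sqrt{\lambda_j}\,u_jf_j$, where $u_1,\dots,u_J$ are independent standard Gaussian variables. Define also $$F_j(x)=\int_0^x(f_j-I_j)\,\mathrm e^{-V},\qquad A_{\mathbb R,j}=-\int_{-\infty}^0(f_j-I_j)\,\mathrm e^{-V}.$$ **Proposition.** Suppose that $0\in\mathfrak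 U_0$. Then: - $C_{\rm c}^\infty(\mathbb R)\subset\mathfrak U_0$. - For every $U\in\mathfrak U_0$, the solutions $\phi_U$ above exist and are unique up to null sets, the expectation defining $\sigma^2[U]$ is finite, and $\sigma^2[U]=\sum_{j=1}^J\lambda_j\,\sigma_{f_j}^2[U]$. - The function $\sqrt{\sum_{j}\lambda_j|F_j-A_{\mathbb R,j}|^2}$ is integrable over $\mathbb R$, and $$\inf_{U\in\mathfrak U_0}\sigma^2[U]=\inf_{U\in C_{\rm c}^\infty(\mathbb R)}\sigma^2[U]=\frac{2}{Z^2}\left(\int_{\mathbb R}\sqrt{\sum_{j=1}^J\lambda_j\,|F_j-A_{\mathbb R,j}|^2}\,\right)^2 .$$ -/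

import Mathlib

open MeasureTheory ProbabilityTheory
open scoped NNReal ContDiff

namespace BiasedLangevin

noncomputable section

/-- The space of smooth compactly supported functions on the real line. -/
def smoothCompact : Set (ℝ → ℝ) := {ψ | ContDiff ℝ ∞ ψ ∧ HasCompactSupport ψ}

/-- The normalization constant `∫ exp (-W)`. -/
def partition (W : ℝ → ℝ) : ℝ := ∫ x, Real.exp (-W x)

/-- The measure with Lebesgue density `exp (-W) / ∫ exp (-W)`. -/
def gibbs (W : ℝ → ℝ) : Measure ℝ := (volume : Measure ℝ).tilted (fun x => -W x)

/-- The mean of `f` with respect to the target measure. -/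
def mean (V f : ℝ → ℝ) : ℝ := ∫ x, f x ∂(gibbs V)

/-- `g` is the distributional derivative of `φ` on the real line. -/
structure HasWeakDeriv (φ g : ℝ → ℝ) : Prop where
  locallyIntegrable : LocallyIntegrable φ
  locallyIntegrable_deriv : LocallyIntegrable g
  integral_eq : ∀ ψ ∈ smoothCompact, ∫ x, φ x * deriv ψ x = - ∫ x, g x * ψ x

/-- `φ` is in `H¹(ν)`, with weak derivative `g`. -/
structure MemH1 (ν : Measure ℝ) (φ g : ℝ → ℝ) : Prop where
  hasWeakDeriv : HasWeakDeriv φ g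
  memLp : MemLp φ 2 ν
  memLp_deriv : MemLp g 2 ν

/-- The Poincaré inequality for `ν`, on the mean-zero functions of `H¹(ν)`. -/
def SatisfiesPoincare (ν : Measure ℝ) : Prop :=
  ∃ R : ℝ, 0 < R ∧ ∀ φ g : ℝ → ℝ, MemH1 ν φ g → ∫ x, φ x ∂ν = 0 →
    ∫ x, φ x ^ 2 ∂ν ≤ 1 / R * ∫ x, g x ^ 2 ∂ν

/-- The augmented natural filtration of a process `B` at time `t`: the sigma-algebra generated by
the values of `B` up to time `t` and by all null sets. -/
abbrev augmentedFiltration {Ω : Type} [MeasurableSpace Ω] (P : Measure Ω) (B : ℝ≥0 → Ω → ℝ)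
    (t : ℝ≥0) : MeasurableSpace Ω :=
  (⨆ s : Set.Iic t, MeasurableSpace.comap (B s) (borel ℝ)) ⊔
    MeasurableSpace.generateFrom {N : Set Ω | P N = 0}

/-- `X` is a strong solution, driven by the Brownian motion `B`, of
`dX_t = - W'(X_t) dt + √2 dB_t` with `X_0 = x₀`. As the noise is additive, the stochastic integral
of the constant `√2` is `√2 B_t`. -/
structure IsStrongSolution {Ω : Type} [MeasurableSpace Ω] (P : Measure Ω) (B : ℝ≥0 → Ω → ℝ)
    (W : ℝ → ℝ) (x₀ : ℝ) (X : ℝ≥0 → Ω → ℝ) : Prop where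
  adapted : ∀ t, Measurable[augmentedFiltration P B t] (X t)
  continuous : ∀ᵐ w ∂P, Continuous fun t => X t w
  equation : ∀ᵐ w ∂P, ∀ t : ℝ≥0,
    X t w = x₀ - (∫ s in (0 : ℝ)..t, deriv W (X s.toNNReal w)) + √2 * B t w

/-- Strong well-posedness of `dX_t = - W'(X_t) dt + √2 dB_t` with `X_0 = x₀`: for every Brownian
motion there is a strong solution, and any two of them are indistinguishable. -/
def HasUniqueStrongSolution (W : ℝ → ℝ) (x₀ : ℝ) : Prop :=
  ∀ (Ω : Type) (_ : MeasurableSpace Ω) (P : Measure Ω) (_ : IsProbabilityMeasure P)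
    (B : ℝ≥0 → Ω → ℝ), IsBrownianReal B P →
    (∃ X, IsStrongSolution P B W x₀ X) ∧
    ∀ X Y, IsStrongSolution P B W x₀ X → IsStrongSolution P B W x₀ Y →
      ∀ᵐ w ∂P, ∀ t, X t w = Y t w

/-- The set of admissible biasing potentials for the potential `V` and the observable `f`. -/
structure IsAdmissible (V f U : ℝ → ℝ) : Prop where
  smooth : ContDiff ℝ ∞ U
  integrable : Integrable fun x => Real.exp (-(V + U) x)
  poincare : SatisfiesPoincare (gibbs (V + U))
  memLp : MemLp (fun x => (f x - mean V f) * Real.exp (U x)) 2 (gibbs (V + U))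
  strongSolution : ∀ x₀ : ℝ, HasUniqueStrongSolution (V + U) x₀

/-- The biasing potentials that are admissible for every observable of a family. -/
def admissible {J : ℕ} (V : ℝ → ℝ) (f : Fin J → ℝ → ℝ) : Set (ℝ → ℝ) :=
  {U | ∀ j, IsAdmissible V (f j) U}

/-- `φ`, with weak derivative `g`, is a mean-zero distributional solution in `H¹(μ_U)` of the
Poisson equation `- exp (V + U) (exp (- V - U) φ')' = (f - μ(f)) exp U`. -/
structure IsPoissonSolution (V U f φ g : ℝ → ℝ) : Prop where
  memH1 : MemH1 (gibbs (V + U)) φ g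
  integral_eq_zero : ∫ x, φ x ∂(gibbs (V + U)) = 0
  weak : ∀ ψ ∈ smoothCompact, ∫ x, g x * deriv ψ x ∂(gibbs (V + U)) =
    ∫ x, (f x - mean V f) * Real.exp (U x) * ψ x ∂(gibbs (V + U))

/-- The Poisson equation has a solution, unique up to null sets. -/
def PoissonWellPosed (V U f : ℝ → ℝ) : Prop :=
  ∃ φ g : ℝ → ℝ, IsPoissonSolution V U f φ g ∧
    ∀ φ₁ g₁ : ℝ → ℝ, IsPoissonSolution V U f φ₁ g₁ →
      φ₁ =ᵐ[volume] φ ∧ g₁ =ᵐ[volume] g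

open Classical in
/-- The asymptotic variance `(2 Z[U]² / Z²) ∫ |φ_U'|² dμ_U`, where `φ_U` is the solution of the
Poisson equation. -/
def asymptoticVariance (V f U : ℝ → ℝ) : ℝ :=
  if h : ∃ p : (ℝ → ℝ) × (ℝ → ℝ), IsPoissonSolution V U f p.1 p.2 then
    2 * partition (V + U) ^ 2 / partition V ^ 2 *
      ∫ x, |(Classical.choose h).2 x| ^ 2 ∂(gibbs (V + U))
  else 0

/-- The observable `∑ √λ_j u_j f_j` with coefficients `u`. -/
def randomObservable {J : ℕ} (lam : Fin J → ℝ) (f : Fin J → ℝ → ℝ) (u : Fin J → ℝ) : ℝ → ℝ :=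
  fun x => ∑ j, √(lam j) * u j * f j x

/-- The law of `J` independent standard Gaussian variables. -/
def stdGaussianPi (J : ℕ) : Measure (Fin J → ℝ) := Measure.pi fun _ => gaussianReal 0 1

/-- The average of the asymptotic variance over the Gaussian random observable
`∑ √λ_j u_j f_j`. -/
def averagedVariance {J : ℕ} (V : ℝ → ℝ) (lam : Fin J → ℝ) (f : Fin J → ℝ → ℝ)
    (U : ℝ → ℝ) : ℝ :=
  ∫ u, asymptoticVariance V (randomObservable lam f u) U ∂(stdGaussianPi J)

/-- `F(x) = ∫_0^x (f - μ(f)) exp (-V)`. -/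
def primitiveF (V f : ℝ → ℝ) (x : ℝ) : ℝ :=
  ∫ ξ in (0 : ℝ)..x, (f ξ - mean V f) * Real.exp (-V ξ)

/-- `A_ℝ = - ∫_{-∞}^0 (f - μ(f)) exp (-V)`. -/
def constA (V f : ℝ → ℝ) : ℝ :=
  - ∫ ξ in Set.Iic (0 : ℝ), (f ξ - mean V f) * Real.exp (-V ξ)

/-- `√(∑ λ_j |F_j - A_{ℝ,j}|²)`. -/
def optimalDensity {J : ℕ} (V : ℝ → ℝ) (lam : Fin J → ℝ) (f : Fin J → ℝ → ℝ) (x : ℝ) : ℝ :=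
  √(∑ j, lam j * |primitiveF V (f j) x - constA V (f j)| ^ 2)

end

end BiasedLangevin

/-!
The flux `F_f = F - A_ℝ = ∫_{-∞}^x (f - μ(f)) exp (-V)` is a primitive of `(f - μ(f)) exp (-V)`
which vanishes at both ends of the line, so the Poisson equation integrates once to
`φ_U' = -F_f exp (V + U)`. This gradient is in `L²(μ_U)` because the Poincaré inequality, tested
against truncated primitives, bounds its `L²` norm, and the solution is unique by the lemma of
du Bois-Reymond. The averaged variance is therefore `2 / Z²` times
`(∫ exp (-V - U)) (∫ s² exp (V + U))` with `s = √(∑ λ_j F_{f_j}²)`.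

By the Cauchy-Schwarz inequality this is at least `2 / Z² (∫ s)²`, with equality at
`exp (-V - U) ∝ s`. As `s` may vanish and need not have compact support, the ideal potential
`-log (s exp V)` is approached by `-χ log q`, where `q` is a smooth positive function slightly
larger than `s exp V` and `χ` is a cutoff. Compactly supported potentials are admissible: the
Poincaré inequality is stable under bounded perturbations, and when the drift is changed on a
compact set only, solutions cannot explode because solutions for the original drift, started at
rational times from integer positions, serve as barriers.
-/

namespace BiasedLangevin

open Set Filter Topology

/-! ### Integral equations with additive noise -/

/-- `X` solves `dX = b(X) dt + dγ` on the time set `I`. The equation is imposed on increments, so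
that a solution can be restricted, restarted and reflected without changing `γ`. -/
structure IsSolutionOn (b γ X : ℝ → ℝ) (I : Set ℝ) : Prop where
  continuous : Continuous X
  sub_eq : ∀ u ∈ I, ∀ v ∈ I, X v - X u = (∫ s in u..v, b (X s)) + (γ v - γ u)

theorem isSolutionOn_of_eq_add_integral {b γ X : ℝ → ℝ} {I : Set ℝ} {r x : ℝ} (hb : Continuous b)
    (hX : Continuous X) (h : ∀ t ∈ I, X t = x + (∫ s in r..t, b (X s)) + γ t) :
    IsSolutionOn b γ X I where
  continuous := hX
  sub_eq u hu v hv := by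
    have hint : ∀ p q, IntervalIntegrable (fun s => b (X s)) volume p q :=
      (hb.comp hX).intervalIntegrable
    rw [h u hu, h v hv, ← intervalIntegral.integral_add_adjacent_intervals (hint r u) (hint u v)]
    ring

namespace IsSolutionOn

variable {a b γ X Y : ℝ → ℝ} {I : Set ℝ} {r s t : ℝ}

theorem mono {J : Set ℝ} (hX : IsSolutionOn b γ X J) (hIJ : I ⊆ J) : IsSolutionOn b γ X I where
  continuous := hX.continuous
  sub_eq u hu v hv := hX.sub_eq u (hIJ hu) v (hIJ hv)

theorem congr_drift [I.OrdConnected] (hX : IsSolutionOn b γ X I)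
    (hab : ∀ s ∈ I, b (X s) = a (X s)) : IsSolutionOn a γ X I where
  continuous := hX.continuous
  sub_eq u hu v hv := by
    rw [hX.sub_eq u hu v hv, intervalIntegral.integral_congr fun s hs =>
      hab s (OrdConnected.uIcc_subset ‹_› hu hv hs)]

theorem congr [I.OrdConnected] (hY : IsSolutionOn b γ Y I) (hX : Continuous X)
    (hXY : EqOn X Y I) : IsSolutionOn b γ X I where
  continuous := hX
  sub_eq u hu v hv := by
    rw [hXY hu, hXY hv, hY.sub_eq u hu v hv, intervalIntegral.integral_congr fun s hs =>
      congrArg b (hXY (OrdConnected.uIcc_subset ‹_› hu hv hs)).symm]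

theorem neg (hX : IsSolutionOn b γ X I) :
    IsSolutionOn (fun y => -b (-y)) (fun t => -γ t) (fun t => -X t) I where
  continuous := hX.continuous.neg
  sub_eq u hu v hv := by
    simp only [neg_neg, intervalIntegral.integral_neg]
    linarith [hX.sub_eq u hu v hv]

theorem eqOn_of_eq (hb : LocallyLipschitz b) (hX : IsSolutionOn b γ X (Icc r t))
    (hY : IsSolutionOn b γ Y (Icc r t)) (hr : X r = Y r) : EqOn X Y (Icc r t) := by
  have hXc := hX.continuous
  have hYc := hY.continuous
  have hbc := hb.continuous
  obtain ⟨L, hL⟩ := hb.locallyLipschitzOn.exists_lipschitzOnWith_of_compact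
    ((isCompact_Icc.image hXc).union (isCompact_Icc (a := r) (b := t) |>.image hYc))
  set D : ℝ → ℝ := fun u => ∫ s in r..u, (b (X s) - b (Y s)) with hD
  have hsub : ∀ u ∈ Icc r t, X u - Y u = D u := fun u hu => by
    have hrt : r ∈ Icc r t := ⟨le_rfl, hu.1.trans hu.2⟩
    have hDu : D u = (∫ s in r..u, b (X s)) - ∫ s in r..u, b (Y s) :=
      intervalIntegral.integral_sub ((hbc.comp hXc).intervalIntegrable _ _)
        ((hbc.comp hYc).intervalIntegrable _ _)
    linarith [hX.sub_eq r hrt u hu, hY.sub_eq r hrt u hu]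
  have hderiv : ∀ u, HasDerivAt D (b (X u) - b (Y u)) u := fun u =>
    (show Continuous fun s => b (X s) - b (Y s) by fun_prop).integral_hasStrictDerivAt r u
      |>.hasDerivAt
  have hzero : ∀ u ∈ Icc r t, D u = 0 := by
    refine eq_zero_of_abs_deriv_le_mul_abs_self_of_eq_zero_right (K := L)
      (f' := fun u => b (X u) - b (Y u)) (fun u _ => (hderiv u).continuousAt.continuousWithinAt)
      (fun u _ => (hderiv u).hasDerivWithinAt) (by simp [hD]) fun u hu => ?_
    have hu := Ico_subset_Icc_self hu
    rw [← hsub u hu]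
    exact hL.norm_sub_le (.inl (mem_image_of_mem X hu)) (.inr (mem_image_of_mem Y hu))
  exact fun u hu => sub_eq_zero.1 ((hsub u hu).trans (hzero u hu))

theorem le_of_le (hb : LocallyLipschitz b) (hX : IsSolutionOn b γ X (Icc r t))
    (hY : IsSolutionOn b γ Y (Icc r t)) (hrt : r ≤ t) (hr : X r ≤ Y r) : X t ≤ Y t := by
  by_contra! hlt
  obtain ⟨q, hq, hXY⟩ := intermediate_value_Icc hrt
    (hX.continuous.sub hY.continuous).continuousOn
    (show (0 : ℝ) ∈ Icc ((X - Y) r) ((X - Y) t) from ⟨by simpa using hr, by simpa using hlt.le⟩)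
  have hsub : Icc q t ⊆ Icc r t := Icc_subset_Icc_left hq.1
  exact hlt.ne' (eqOn_of_eq hb (hX.mono hsub) (hY.mono hsub) (sub_eq_zero.1 hXY) ⟨hq.2, le_rfl⟩)

end IsSolutionOn

theorem exists_upcrossing {X : ℝ → ℝ} (hX : Continuous X) {r v m M : ℝ} (hrv : r ≤ v)
    (hmM : m < M) (hr : X r ≤ m) (hv : M ≤ X v) :
    ∃ s t, r ≤ s ∧ s < t ∧ t ≤ v ∧ X s = m ∧ X t = M ∧ ∀ u ∈ Icc s t, X u ∈ Icc m M := by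
  have hlevel : ∀ p q y, IsCompact {u ∈ Icc p q | X u = y} := fun p q y =>
    isCompact_Icc.inter_right (isClosed_eq hX continuous_const)
  obtain ⟨t, ⟨ht, hXt⟩, htmin⟩ := (hlevel r v M).exists_isLeast
    (intermediate_value_Icc hrv hX.continuousOn ⟨hr.trans hmM.le, hv⟩)
  obtain ⟨s, ⟨hs, hXs⟩, hsmax⟩ := (hlevel r t m).exists_isGreatest
    (intermediate_value_Icc ht.1 hX.continuousOn ⟨hr, hmM.le.trans hXt.ge⟩)
  have hst : s ≠ t := fun h => hmM.ne (by rw [← hXs, ← hXt, h])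
  refine ⟨s, t, hs.1, lt_of_le_of_ne hs.2 hst, ht.2, hXs, hXt, fun u hu => ⟨?_, ?_⟩⟩
  · by_contra! hlt
    obtain ⟨w, hw, hXw⟩ := intermediate_value_Icc hu.2 hX.continuousOn
      ⟨hlt.le, hmM.le.trans hXt.ge⟩
    have hws : w ≤ s := hsmax ⟨⟨(hs.1.trans hu.1).trans hw.1, hw.2⟩, hXw⟩
    exact hlt.ne (by rw [← hXw, le_antisymm hw.1 (hws.trans hu.1)])
  · by_contra! hlt
    have hru := hs.1.trans hu.1
    obtain ⟨w, hw, hXw⟩ := intermediate_value_Icc hru hX.continuousOn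
      ⟨hr.trans hmM.le, hlt.le⟩
    have htw : t ≤ w := htmin ⟨⟨hw.1, hw.2.trans (hu.2.trans ht.2)⟩, hXw⟩
    exact hlt.ne (by rw [← hXw, le_antisymm hw.2 (hu.2.trans htw)])

theorem IsSolutionOn.lt_add {b γ X : ℝ → ℝ} {s t m c δ : ℝ} (hX : IsSolutionOn b γ X (Icc s t))
    (hδ : 0 < δ) (hs : X s ≤ m) (hc : ∀ y ∈ Icc m (m + δ), |b y| ≤ c)
    (hsmall : ∀ u ∈ Icc s t, ∀ v ∈ Icc s t, u ≤ v → (c * v + γ v) - (c * u + γ u) < δ) :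
    ∀ u ∈ Icc s t, X u < m + δ := by
  by_contra! ⟨v, hv, hXv⟩
  obtain ⟨p, q, hsp, hpq, hqv, hXp, hXq, hmem⟩ :=
    exists_upcrossing hX.continuous hv.1 (lt_add_of_pos_right m hδ) hs hXv
  have hp : p ∈ Icc s t := ⟨hsp, hpq.le.trans (hqv.trans hv.2)⟩
  have hq : q ∈ Icc s t := ⟨hsp.trans hpq.le, hqv.trans hv.2⟩
  have hdrift : ∫ u in p..q, b (X u) ≤ c * (q - p) := by
    rw [← abs_of_nonneg (sub_nonneg.2 hpq.le)]
    refine (Real.le_norm_self _).trans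
      (intervalIntegral.norm_integral_le_of_norm_le_const fun u hu => ?_)
    rw [uIoc_of_le hpq.le] at hu
    exact hc _ (hmem u (Ioc_subset_Icc_self hu))
  linarith [hX.sub_eq p hp q hq, hsmall p hp q hq hpq.le]

theorem exists_finset_rat_mem_Ico (T : ℝ) {d : ℝ} (hd : 0 < d) :
    ∃ Q : Finset ℚ, (∀ q ∈ Q, 0 ≤ q) ∧ ∀ s ∈ Icc 0 T, ∃ q ∈ Q, (q : ℝ) ∈ Ico s (s + d) := by
  obtain ⟨p, hp⟩ := exists_nat_gt (1 / d)
  have hp0 : (0 : ℝ) < p := (one_div_pos.2 hd).trans hp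
  refine ⟨(Finset.range (⌈T * p⌉₊ + 1)).image fun k : ℕ => (k : ℚ) / p, fun q hq => ?_,
    fun s hs => ⟨_, Finset.mem_image_of_mem _ (Finset.mem_range_succ_iff.2
      (Nat.ceil_mono (mul_le_mul_of_nonneg_right hs.2 hp0.le))), ?_, ?_⟩⟩
  · obtain ⟨k, -, rfl⟩ := Finset.mem_image.1 hq
    positivity
  · push_cast
    exact (le_div_iff₀ hp0).2 (Nat.le_ceil _)
  · push_cast
    rw [div_lt_iff₀ hp0, add_mul]
    have hdp : 1 < d * p := by rwa [div_lt_iff₀' hd] at hp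
    linarith [Nat.ceil_lt_add_one (mul_nonneg hs.1 hp0.le)]

/-- The equation `dZ = a(Z) dt + dγ` can be solved from every rational time and integer position.
There are countably many such starting points, so for a random `γ` this is an almost sure property
as soon as it holds almost surely for each of them. -/
def SolvableFromRational (a γ : ℝ → ℝ) : Prop :=
  ∀ q : ℚ, 0 ≤ q → ∀ n : ℤ, ∃ Z : ℝ → ℝ, IsSolutionOn a γ Z (Ici (q : ℝ)) ∧ Z q = n

theorem SolvableFromRational.neg {a γ : ℝ → ℝ} (h : SolvableFromRational a γ) :
    SolvableFromRational (fun y => -a (-y)) fun t => -γ t := fun q hq n => by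
  obtain ⟨Z, hZ, hZq⟩ := h q hq (-n)
  exact ⟨_, hZ.neg, by simp [hZq]⟩

theorem SolvableFromRational.exists_bddAbove {a γ : ℝ → ℝ} (h : SolvableFromRational a γ)
    {Q : Finset ℚ} (hQ : ∀ q ∈ Q, 0 ≤ q) (N : ℤ) (T : ℝ) :
    ∃ M : ℝ, ∀ q ∈ Q, ∃ Z : ℝ → ℝ, IsSolutionOn a γ Z (Ici (q : ℝ)) ∧ Z q = N ∧
      ∀ t ∈ Icc 0 T, Z t ≤ M := by
  choose! Z hZ hZq using fun q hq => h q hq N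
  have hbdd : ∀ q, 0 ≤ q → ∃ C, ∀ t ∈ Icc 0 T, Z q t ≤ C := fun q hq => by
    obtain ⟨C, hC⟩ := isCompact_Icc.bddAbove_image (hZ q hq).continuous.continuousOn
    exact ⟨C, fun t ht => hC (mem_image_of_mem _ ht)⟩
  choose! C hC using hbdd
  obtain ⟨M, hM⟩ := (Q.image C).exists_le
  exact ⟨M, fun q hq => ⟨Z q, hZ q (hQ q hq), hZq q (hQ q hq), fun t ht =>
    (hC q (hQ q hq) t ht).trans (hM _ (Finset.mem_image_of_mem C hq))⟩⟩

/-- If `X` climbs from `m := max K x₀` to a high level `M`, then shortly after leaving `m`, at a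
time `q` of a fixed finite rational grid, it is still below `N`, hence afterwards it stays below the
solution of the equation with drift `a` restarted from `N` at time `q`. -/
theorem exists_upper_barrier {a γ : ℝ → ℝ} (ha : LocallyLipschitz a) (hγ : Continuous γ)
    (h : SolvableFromRational a γ) (x₀ K T : ℝ) :
    ∃ M : ℝ, ∀ b X : ℝ → ℝ, EqOn b a (Icc K M) → IsSolutionOn b γ X (Icc 0 T) → X 0 ≤ x₀ →
      ∀ t ∈ Icc 0 T, X t < M := by
  set m := max K x₀
  obtain ⟨c, hc⟩ := (isCompact_Icc (a := m) (b := m + 1)).exists_bound_of_continuousOn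
    ha.continuous.continuousOn
  obtain ⟨d, hd, hsmall⟩ := Metric.uniformContinuousOn_iff.1
    ((isCompact_Icc (a := 0) (b := T)).uniformContinuousOn_of_continuous
      (show Continuous fun t => c * t + γ t by fun_prop).continuousOn) 1 one_pos
  obtain ⟨Q, hQ, hQT⟩ := exists_finset_rat_mem_Ico T hd
  obtain ⟨N, hN⟩ := exists_int_gt (m + 1)
  obtain ⟨M₀, hM₀⟩ := h.exists_bddAbove hQ N T
  obtain ⟨M, hM⟩ := exists_gt (max M₀ (m + 1))
  obtain ⟨hMM₀, hMm⟩ := max_lt_iff.1 hM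
  refine ⟨M, fun b X hba hX hX0 => ?_⟩
  by_contra! ⟨v, hv, hXv⟩
  obtain ⟨s, t, hs, hst, htv, hXs, hXt, hmem⟩ := exists_upcrossing hX.continuous hv.1
    (show m < M by linarith) (hX0.trans (le_max_right K x₀)) hXv
  have htT := htv.trans hv.2
  have hXa : IsSolutionOn a γ X (Icc s t) := (hX.mono (Icc_subset_Icc hs htT)).congr_drift
    fun u hu => hba ⟨(le_max_left K x₀).trans (hmem u hu).1, (hmem u hu).2⟩
  obtain ⟨q, hqQ, hsq, hqs⟩ := hQT s ⟨hs, hst.le.trans htT⟩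
  have hlt : ∀ u ∈ Icc s (min (q : ℝ) t), X u < m + 1 := by
    refine (hXa.mono (Icc_subset_Icc_right (min_le_right _ _))).lt_add one_pos hXs.le hc
      fun u hu v hv huv => (le_abs_self _).trans_lt (hsmall v ⟨hs.trans hv.1, ?_⟩ u
        ⟨hs.trans hu.1, ?_⟩ ?_)
    · exact hv.2.trans ((min_le_right _ _).trans htT)
    · exact hu.2.trans ((min_le_right _ _).trans htT)
    · rw [Real.dist_eq, abs_of_nonneg (sub_nonneg.2 huv)]
      linarith [hu.1, hv.2.trans (min_le_left _ _)]
  rcases lt_or_ge (q : ℝ) t with hqt | htq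
  · obtain ⟨Z, hZ, hZq, hZM⟩ := hM₀ q hqQ
    have hXZ : X t ≤ Z t := (hXa.mono (Icc_subset_Icc_left hsq)).le_of_le ha
      (hZ.mono Icc_subset_Ici_self) hqt.le
      (by linarith [hlt q ⟨hsq, le_min le_rfl hqt.le⟩])
    linarith [hZM t ⟨hs.trans hst.le, htT⟩]
  · linarith [hlt t ⟨hst.le, le_min htq le_rfl⟩]

/-- The drift `a` frozen outside `[-n, n]`. -/
noncomputable def truncate (a : ℝ → ℝ) (n : ℕ) (y : ℝ) : ℝ :=
  a (projIcc (-n : ℝ) n (neg_le_self n.cast_nonneg) y)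

theorem continuous_truncate {a : ℝ → ℝ} (ha : Continuous a) (n : ℕ) :
    Continuous (truncate a n) :=
  ha.comp (continuous_subtype_val.comp continuous_projIcc)

theorem truncate_eq {a : ℝ → ℝ} {n : ℕ} {y : ℝ} (hy : |y| ≤ n) : truncate a n y = a y := by
  rw [truncate, projIcc_of_mem _ (abs_le.1 hy)]

theorem exists_abs_truncate_le {a : ℝ → ℝ} (ha : Continuous a) (n : ℕ) :
    ∃ C, ∀ y, |truncate a n y| ≤ C := by
  obtain ⟨C, hC⟩ := (isCompact_Icc (a := (-n : ℝ)) (b := n)).exists_bound_of_continuousOn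
    ha.continuousOn
  exact ⟨C, fun y => hC _ (Subtype.property _)⟩

theorem exists_lipschitzWith_truncate {a : ℝ → ℝ} (ha : LocallyLipschitz a) (n : ℕ) :
    ∃ L, LipschitzWith L (truncate a n) := by
  obtain ⟨L, hL⟩ := ha.locallyLipschitzOn.exists_lipschitzOnWith_of_compact
    (isCompact_Icc (a := (-n : ℝ)) (b := n))
  exact ⟨L * 1, hL.to_restrict.comp (LipschitzWith.projIcc _)⟩

theorem exists_abs_le_of_solvableFromRational {a a₁ γ : ℝ → ℝ} (ha : LocallyLipschitz a)
    (hγ : Continuous γ) (h : SolvableFromRational a γ) {K : ℝ} (hK : ∀ y, K ≤ |y| → a₁ y = a y)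
    (x₀ T : ℝ) :
    ∃ N : ℕ, ∀ n ≥ N, ∀ X, IsSolutionOn (truncate a₁ n) γ X (Icc 0 T) → X 0 = x₀ →
      ∀ t ∈ Icc 0 T, |X t| ≤ n := by
  have ha_neg : LocallyLipschitz fun y => -a (-y) :=
    (LipschitzWith.id.neg.locallyLipschitz.comp ha).comp LipschitzWith.id.neg.locallyLipschitz
  obtain ⟨M₁, hM₁⟩ := exists_upper_barrier ha hγ h x₀ (max K 0) T
  obtain ⟨M₂, hM₂⟩ := exists_upper_barrier ha_neg hγ.neg h.neg (-x₀) (max K 0) T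
  obtain ⟨N, hN⟩ := exists_nat_ge (max M₁ M₂)
  obtain ⟨hN₁, hN₂⟩ := max_le_iff.1 hN
  refine ⟨N, fun n hn X hX hX0 t ht => ?_⟩
  have hn : (N : ℝ) ≤ n := by exact_mod_cast hn
  have heq : ∀ y, max K 0 ≤ |y| → |y| ≤ N → truncate a₁ n y = a y := fun y hy hyN =>
    (truncate_eq (hyN.trans hn)).trans (hK y ((le_max_left _ _).trans hy))
  have habs : ∀ y, max K 0 ≤ y → |y| = y := fun y hy => abs_of_nonneg ((le_max_right _ _).trans hy)
  have hupper : X t < M₁ := hM₁ _ X (fun y hy => heq y (by rw [habs y hy.1]; exact hy.1)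
    (by rw [habs y hy.1]; exact hy.2.trans hN₁)) hX hX0.le t ht
  have hlower : -X t < M₂ := hM₂ _ _ (fun y hy => congrArg Neg.neg
    (heq (-y) (by rw [abs_neg, habs y hy.1]; exact hy.1)
      (by rw [abs_neg, habs y hy.1]; exact hy.2.trans hN₂))) hX.neg (by rw [hX0]) t ht
  exact abs_le.2 ⟨by linarith, by linarith⟩

/-! ### Picard iteration -/

/-- The Picard iterates of `X t = γ t + ∫ s in 0..t, b (X s)`. -/
noncomputable def picardIterate (b γ : ℝ → ℝ) : ℕ → ℝ → ℝ
  | 0 => γ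
  | k + 1 => fun t => γ t + ∫ s in (0 : ℝ)..t, b (picardIterate b γ k s)

section Picard

variable {b γ : ℝ → ℝ} {C : ℝ} {L : ℝ≥0}

theorem continuous_picardIterate (hb : Continuous b) (hγ : Continuous γ) (k : ℕ) :
    Continuous (picardIterate b γ k) := by
  induction k with
  | zero => exact hγ
  | succ k ih =>
    exact hγ.add (intervalIntegral.continuous_primitive
      (fun _ _ => (hb.comp ih).intervalIntegrable _ _) 0)

theorem abs_picardIterate_succ_sub_le (hγ : Continuous γ) (hb : LipschitzWith L b)
    (hC : ∀ y, |b y| ≤ C) (k : ℕ) {t : ℝ} (ht : 0 ≤ t) :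
    |picardIterate b γ (k + 1) t - picardIterate b γ k t| ≤
      C * L ^ k * (t ^ (k + 1) / (k + 1).factorial) := by
  have hint : ∀ k u v, IntervalIntegrable (fun s => b (picardIterate b γ k s)) volume u v :=
    fun k => (hb.continuous.comp (continuous_picardIterate hb.continuous hγ k)).intervalIntegrable
  induction k generalizing t with
  | zero =>
    simpa [picardIterate, abs_of_nonneg ht] using
      intervalIntegral.norm_integral_le_of_norm_le_const (a := 0) (b := t) (C := C)
        (f := fun s => b (γ s)) fun s _ => hC _
  | succ k ih =>
    have hsub : picardIterate b γ (k + 1 + 1) t - picardIterate b γ (k + 1) t =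
        ∫ s in (0 : ℝ)..t, (b (picardIterate b γ (k + 1) s) - b (picardIterate b γ k s)) := by
      rw [intervalIntegral.integral_sub (hint _ _ _) (hint _ _ _)]
      simp only [picardIterate]
      ring
    have hpow : Continuous fun s : ℝ => L * (C * L ^ k * (s ^ (k + 1) / (k + 1).factorial)) := by
      fun_prop
    calc |picardIterate b γ (k + 1 + 1) t - picardIterate b γ (k + 1) t|
      _ ≤ ∫ s in (0 : ℝ)..t, L * (C * L ^ k * (s ^ (k + 1) / (k + 1).factorial)) := by
        rw [hsub, ← Real.norm_eq_abs]
        refine intervalIntegral.norm_integral_le_of_norm_le ht (.of_forall fun s hs => ?_)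
          (hpow.intervalIntegrable (μ := volume) _ _)
        exact (hb.norm_sub_le _ _).trans (mul_le_mul_of_nonneg_left (ih hs.1.le) L.2)
      _ = C * L ^ (k + 1) * (t ^ (k + 1 + 1) / (k + 1 + 1).factorial) := by
        simp only [intervalIntegral.integral_const_mul, intervalIntegral.integral_div,
          integral_pow]
        rw [Nat.factorial_succ (k + 1)]
        push_cast
        field_simp
        ring

theorem exists_tendsto_picardIterate (hγ : Continuous γ) (hb : LipschitzWith L b)
    (hC : ∀ y, |b y| ≤ C) {t : ℝ} (ht : 0 ≤ t) :
    ∃ x, Tendsto (fun k => picardIterate b γ k t) atTop (𝓝 x) := by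
  refine cauchySeq_tendsto_of_complete (cauchySeq_of_dist_le_of_summable
    (fun k => C * L ^ k * (t ^ (k + 1) / k.factorial)) (fun k => ?_) ?_)
  · have hC0 : 0 ≤ C := (abs_nonneg _).trans (hC 0)
    rw [dist_comm, Real.dist_eq]
    refine (abs_picardIterate_succ_sub_le hγ hb hC k ht).trans ?_
    gcongr
    exact k.le_succ
  · refine ((Real.summable_pow_div_factorial (L * t)).mul_left (C * t)).congr fun k => ?_
    rw [mul_pow]
    ring

theorem exists_isSolutionOn_tendsto_picardIterate (hγ : Continuous γ) (hb : LipschitzWith L b)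
    (hC : ∀ y, |b y| ≤ C) :
    ∃ X, IsSolutionOn b γ X (Ici 0) ∧ X 0 = γ 0 ∧
      ∀ t, 0 ≤ t → Tendsto (fun k => picardIterate b γ k t) atTop (𝓝 (X t)) := by
  have hcont := continuous_picardIterate hb.continuous hγ
  have hC0 : 0 ≤ C := (abs_nonneg _).trans (hC 0)
  choose Y hY using fun t : ℝ => exists_tendsto_picardIterate hγ hb hC (le_max_right t 0)
  have hYm : Measurable Y := measurable_of_tendsto_metrizable
    (fun k => ((hcont k).comp (continuous_id.max continuous_const)).measurable)
    (tendsto_pi_nhds.2 hY)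
  have hint : ∀ u v, IntervalIntegrable (fun s => b (Y s)) volume u v := fun u v =>
    (intervalIntegrable_const (c := C)).mono_fun
      (hb.continuous.measurable.comp hYm).aestronglyMeasurable
      (.of_forall fun s => by simpa [abs_of_nonneg hC0] using hC (Y s))
  set X : ℝ → ℝ := fun t => γ t + ∫ s in (0 : ℝ)..t, b (Y s) with hX
  have hXc : Continuous X := hγ.add (intervalIntegral.continuous_primitive hint 0)
  have hlim : ∀ t, 0 ≤ t → Tendsto (fun k => picardIterate b γ k t) atTop (𝓝 (Y t)) :=
    fun t ht => by simpa only [max_eq_left ht] using hY t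
  have hYX : ∀ t, 0 ≤ t → Y t = X t := fun t ht => by
    refine tendsto_nhds_unique ((hlim t ht).comp (tendsto_add_atTop_nat 1))
      (tendsto_const_nhds.add
        (intervalIntegral.tendsto_integral_filter_of_dominated_convergence (fun _ => C)
          (.of_forall fun k => (hb.continuous.comp (hcont k)).aestronglyMeasurable)
          (.of_forall fun k => .of_forall fun s _ => hC _) intervalIntegrable_const
          (.of_forall fun s hs => (hb.continuous.tendsto _).comp (hlim s ?_))))
    rw [uIoc_of_le ht] at hs
    exact hs.1.le
  refine ⟨X, isSolutionOn_of_eq_add_integral (r := 0) (x := 0) hb.continuous hXc fun t ht => ?_,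
    by simp [hX], fun t ht => hYX t ht ▸ hlim t ht⟩
  have hYXb : ∫ s in (0 : ℝ)..t, b (Y s) = ∫ s in (0 : ℝ)..t, b (X s) :=
    intervalIntegral.integral_congr fun s hs => by
      rw [uIcc_of_le ht] at hs
      exact congrArg b (hYX s hs.1)
  rw [zero_add, ← hYXb, add_comm]

end Picard

theorem exists_global_solution {a a₁ γ : ℝ → ℝ} (ha : LocallyLipschitz a)
    (ha₁ : LocallyLipschitz a₁) (hγ : Continuous γ) (h : SolvableFromRational a γ) {K : ℝ}
    (hK : ∀ y, K ≤ |y| → a₁ y = a y) {x₀ : ℝ} {Y : ℕ → ℝ → ℝ}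
    (hY : ∀ n, IsSolutionOn (truncate a₁ n) γ (Y n) (Ici 0)) (hY0 : ∀ n, Y n 0 = x₀) :
    ∃ X : ℝ → ℝ, IsSolutionOn a₁ γ X (Ici 0) ∧ X 0 = x₀ ∧
      ∀ t, 0 ≤ t → ∀ᶠ n in atTop, Y n t = X t := by
  choose N hN using fun T : ℝ => exists_abs_le_of_solvableFromRational ha hγ h hK x₀ T
  have hsol : ∀ T, ∀ n ≥ N T, IsSolutionOn a₁ γ (Y n) (Icc 0 T) := fun T n hn => by
    have hYT := (hY n).mono fun t (ht : t ∈ Icc 0 T) => ht.1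
    exact hYT.congr_drift fun s hs => truncate_eq (hN T n hn (Y n) hYT (hY0 n) s hs)
  have heq : ∀ T, ∀ m ≥ N T, ∀ n ≥ N T, EqOn (Y m) (Y n) (Icc 0 T) := fun T m hm n hn =>
    (hsol T m hm).eqOn_of_eq ha₁ (hsol T n hn) ((hY0 m).trans (hY0 n).symm)
  set X : ℝ → ℝ := fun t => Y (N (max t 0)) (max t 0) with hX
  have hXY : ∀ T, ∀ n ≥ N T, ∀ t ≤ T, 0 ≤ T → X t = Y n (max t 0) := fun T n hn t ht hT => by
    have ht' : max t 0 ≤ T := max_le ht hT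
    set k := max (N (max t 0)) n
    calc X t
      _ = Y k (max t 0) :=
        heq (max t 0) _ le_rfl k (le_max_left _ _) ⟨le_max_right _ _, le_rfl⟩
      _ = Y n (max t 0) := heq T k (hn.trans (le_max_right _ _)) n hn ⟨le_max_right _ _, ht'⟩
  have hXc : Continuous X := continuous_iff_continuousAt.2 fun t => by
    set T := max t 0 + 1
    have htT : t < T := by linarith [le_max_left t 0]
    have hYc : Continuous fun s => Y (N T) (max s 0) :=
      (hY _).continuous.comp (continuous_id.max continuous_const)
    refine hYc.continuousAt.congr ?_
    filter_upwards [Iio_mem_nhds htT] with s hs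
    exact (hXY T _ le_rfl s (le_of_lt hs) (by positivity)).symm
  refine ⟨X, ⟨hXc, fun u hu v hv => ?_⟩, by simp [hX, hY0], fun t ht => ?_⟩
  · set T := max u v
    refine ((hsol T _ le_rfl).congr hXc fun s hs => ?_).sub_eq u ⟨hu, le_max_left _ _⟩ v
      ⟨hv, le_max_right _ _⟩
    rw [hXY T _ le_rfl s hs.2 (hs.1.trans hs.2), max_eq_left hs.1]
  · filter_upwards [eventually_ge_atTop (N t)] with n hn
    rw [hXY t n hn t le_rfl ht, max_eq_left ht]

/-! ### Strong solutions -/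

theorem measurable_intervalIntegral_of_continuous {Ω : Type*} [MeasurableSpace Ω]
    {u : ℝ → Ω → ℝ} {t : ℝ} (ht : 0 ≤ t) (hc : ∀ w, Continuous fun s => u s w)
    (hm : ∀ s ∈ Icc 0 t, Measurable (u s)) :
    Measurable fun w => ∫ s in (0 : ℝ)..t, u s w := by
  have hclamp : ∀ w, ∫ s in (0 : ℝ)..t, u s w = ∫ s in Ioc 0 t, u (projIcc 0 t ht s) w := by
    intro w
    rw [intervalIntegral.integral_of_le ht]
    refine setIntegral_congr_fun measurableSet_Ioc fun s hs => ?_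
    rw [projIcc_of_mem ht (Ioc_subset_Icc_self hs)]
  simp only [hclamp]
  have hjoint := measurable_uncurry_of_continuous_of_measurable
    (u := fun s w => u (projIcc 0 t ht s) w)
    (fun w => (hc w).comp (continuous_subtype_val.comp continuous_projIcc))
    fun s => hm _ (Subtype.property _)
  exact hjoint.stronglyMeasurable.integral_prod_left.measurable

theorem measurable_picardIterate {Ω : Type*} {F : ℝ≥0 → MeasurableSpace Ω} (hF : Monotone F)
    {b : ℝ → ℝ} (hb : Continuous b) {γ : Ω → ℝ → ℝ} (hγ : ∀ w, Continuous (γ w))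
    (hm : ∀ t : ℝ≥0, Measurable[F t] fun w => γ w t) (k : ℕ) (t : ℝ≥0) :
    Measurable[F t] fun w => picardIterate b (γ w) k t := by
  induction k generalizing t with
  | zero => exact hm t
  | succ k ih =>
    refine Measurable.add (hm t) ?_
    let _ := F t
    refine measurable_intervalIntegral_of_continuous t.2
      (fun w => hb.comp (continuous_picardIterate hb (hγ w) k)) fun s hs => ?_
    exact hb.measurable.comp
      ((ih ⟨s, hs.1⟩).mono (hF (show (⟨s, hs.1⟩ : ℝ≥0) ≤ t from hs.2)) le_rfl)

theorem exists_adapted_solution {Ω : Type*} {F : ℝ≥0 → MeasurableSpace Ω} (hF : Monotone F)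
    {a a₁ : ℝ → ℝ} (ha : LocallyLipschitz a) (ha₁ : LocallyLipschitz a₁) {K : ℝ}
    (hK : ∀ y, K ≤ |y| → a₁ y = a y) {γ : Ω → ℝ → ℝ} (hγ : ∀ w, Continuous (γ w))
    (hm : ∀ t : ℝ≥0, Measurable[F t] fun w => γ w t) {S : Set Ω}
    (hS : ∀ t, MeasurableSet[F t] S) (h : ∀ w ∈ S, SolvableFromRational a (γ w)) :
    ∃ X : Ω → ℝ → ℝ, (∀ t : ℝ≥0, Measurable[F t] fun w => X w t) ∧
      ∀ w ∈ S, IsSolutionOn a₁ (γ w) (X w) (Ici 0) ∧ X w 0 = γ w 0 := by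
  have htrunc : ∀ (n : ℕ) (w : Ω), ∃ Y, IsSolutionOn (truncate a₁ n) (γ w) Y (Ici 0) ∧
      Y 0 = γ w 0 ∧ ∀ t, 0 ≤ t → Tendsto (fun k => picardIterate (truncate a₁ n) (γ w) k t)
        atTop (𝓝 (Y t)) := fun n w => by
    obtain ⟨C, hC⟩ := exists_abs_truncate_le ha₁.continuous n
    obtain ⟨L, hL⟩ := exists_lipschitzWith_truncate ha₁ n
    exact exists_isSolutionOn_tendsto_picardIterate (hγ w) hL hC
  choose Y hY hY0 hYlim using htrunc
  have hYm : ∀ n (t : ℝ≥0), Measurable[F t] fun w => Y n w t := fun n t =>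
    @measurable_of_tendsto_metrizable _ _ (F t) _ _ _ _ _ _
      (measurable_picardIterate hF (continuous_truncate ha₁.continuous n) hγ hm · t)
      (tendsto_pi_nhds.2 fun w => hYlim n w t t.2)
  classical
  choose! X hX hX0 hXY using fun w hw =>
    exists_global_solution ha ha₁ (hγ w) (h w hw) hK (fun n => hY n w) fun n => hY0 n w
  refine ⟨fun w t => S.indicator (fun w => X w t) w, fun t => ?_, fun w hw => ?_⟩
  · refine @measurable_of_tendsto_metrizable _ _ (F t) _ _ _ _ _ _
      (fun n => (hYm n t).indicator (hS t)) (tendsto_pi_nhds.2 fun w => ?_)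
    by_cases hw : w ∈ S
    · simp only [indicator_of_mem hw]
      exact tendsto_const_nhds.congr' ((hXY w hw t t.2).mono fun n hn => hn.symm)
    · simp only [indicator_of_notMem hw, tendsto_const_nhds]
  · simp only [indicator_of_mem hw]
    exact ⟨hX w hw, hX0 w hw⟩

/-- The noise `x₀ + √2 B` of the Langevin equation started from `x₀`, frozen at negative times. -/
noncomputable def noise {Ω : Type*} (B : ℝ≥0 → Ω → ℝ) (x₀ : ℝ) (w : Ω) (s : ℝ) : ℝ :=
  x₀ + √2 * B s.toNNReal w

theorem continuous_noise {Ω : Type*} {B : ℝ≥0 → Ω → ℝ} {w : Ω}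
    (hw : Continuous fun t => B t w) (x₀ : ℝ) :
    Continuous (noise B x₀ w) := by
  unfold noise
  fun_prop

theorem locallyLipschitz_neg_deriv {W : ℝ → ℝ} (hW : ContDiff ℝ ∞ W) :
    LocallyLipschitz fun y => -deriv W y :=
  (((contDiff_infty_iff_deriv.1 hW).2.of_le (by norm_cast)).neg : ContDiff ℝ 1 _).locallyLipschitz

section BrownianNoise

variable {Ω : Type} [MeasurableSpace Ω] {P : Measure Ω} {B : ℝ≥0 → Ω → ℝ}

theorem monotone_augmentedFiltration : Monotone (augmentedFiltration P B) := by
  intro s t hst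
  refine sup_le_sup_right (iSup_le fun r => ?_) _
  exact le_iSup (fun r : Iic t => MeasurableSpace.comap (B r) (borel ℝ)) ⟨r, r.2.trans hst⟩

theorem measurable_augmentedFiltration (t : ℝ≥0) : Measurable[augmentedFiltration P B t] (B t) := by
  rw [measurable_iff_comap_le, BorelSpace.measurable_eq (α := ℝ)]
  exact le_sup_of_le_left
    (le_iSup (fun r : Iic t => MeasurableSpace.comap (B r) (borel ℝ)) ⟨t, le_refl t⟩)

theorem measurableSet_augmentedFiltration_of_ae {S : Set Ω} (hS : ∀ᵐ w ∂P, w ∈ S) (t : ℝ≥0) :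
    MeasurableSet[augmentedFiltration P B t] S := by
  have hnull : MeasurableSet[augmentedFiltration P B t] Sᶜ :=
    (le_sup_right : MeasurableSpace.generateFrom {N : Set Ω | P N = 0} ≤
      augmentedFiltration P B t) _ (MeasurableSpace.measurableSet_generateFrom hS)
  exact hnull.of_compl

theorem IsStrongSolution.ae_isSolutionOn {W : ℝ → ℝ} {x₀ : ℝ} {X : ℝ≥0 → Ω → ℝ}
    (hX : IsStrongSolution P B W x₀ X) (hW : Continuous (deriv W)) :
    ∀ᵐ w ∂P, IsSolutionOn (fun y => -deriv W y) (noise B x₀ w) (fun s => X s.toNNReal w)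
      (Ici 0) := by
  filter_upwards [hX.continuous, hX.equation] with w hc he
  refine isSolutionOn_of_eq_add_integral (r := 0) (x := 0) hW.neg (hc.comp (by fun_prop))
    fun t ht => ?_
  rw [he, noise, intervalIntegral.integral_neg, Real.coe_toNNReal _ ht]
  ring

theorem ae_solvableFromRational {W : ℝ → ℝ} (h : ∀ x₀, HasUniqueStrongSolution W x₀)
    (hW : Continuous (deriv W)) [IsProbabilityMeasure P] (hB : IsBrownianReal B P) (x₀ : ℝ) :
    ∀ᵐ w ∂P, SolvableFromRational (fun y => -deriv W y) (noise B x₀ w) := by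
  refine ae_all_iff.2 fun q => ae_all_iff.2 fun hq => ae_all_iff.2 fun n => ?_
  have hq : (0 : ℝ) ≤ q := by exact_mod_cast hq
  obtain ⟨⟨X, hX⟩, -⟩ := h n Ω _ P inferInstance _ (hB.shift (q : ℝ).toNNReal)
  filter_upwards [hX.continuous, hX.equation] with w hc he
  have hX' : ∀ u ∈ Ici (q : ℝ), X (u - q).toNNReal w = (n - noise B x₀ w q) +
      (∫ s in (q : ℝ)..u, -deriv W (X (s - q).toNNReal w)) + noise B x₀ w u := fun u hu => by
    have huq : 0 ≤ u - q := sub_nonneg.2 hu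
    rw [intervalIntegral.integral_comp_sub_right (fun s => -deriv W (X s.toNNReal w)) (q : ℝ),
      he, Real.coe_toNNReal _ huq, sub_self, ← Real.toNNReal_add hq huq, add_sub_cancel,
      intervalIntegral.integral_neg, noise, noise]
    ring
  refine ⟨fun u => X (u - q).toNNReal w, isSolutionOn_of_eq_add_integral hW.neg
    (hc.comp (by fun_prop)) hX', ?_⟩
  change X _ w = _
  rw [hX' q self_mem_Ici, intervalIntegral.integral_same]
  ring

variable {W W₁ : ℝ → ℝ} {K : ℝ}

theorem exists_isStrongSolution_of_deriv_eq [IsProbabilityMeasure P] (hB : IsBrownianReal B P)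
    (hW : ContDiff ℝ ∞ W) (hW₁ : ContDiff ℝ ∞ W₁) (hK : ∀ y, K ≤ |y| → deriv W₁ y = deriv W y)
    (h : ∀ x₀, HasUniqueStrongSolution W x₀) (x₀ : ℝ) :
    ∃ X, IsStrongSolution P B W₁ x₀ X := by
  have ha := locallyLipschitz_neg_deriv hW
  set S : Set Ω := {w | Continuous (fun t => B t w) ∧
    SolvableFromRational (fun y => -deriv W y) (noise B x₀ w)}
  have hSae : ∀ᵐ w ∂P, w ∈ S := hB.cont.and
    (ae_solvableFromRational h (contDiff_infty_iff_deriv.1 hW).2.continuous hB x₀)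
  have hSm := measurableSet_augmentedFiltration_of_ae (B := B) hSae
  set γ : Ω → ℝ → ℝ := fun w s => S.indicator (fun w => noise B x₀ w s) w with hγ
  have hγS : ∀ w ∈ S, γ w = noise B x₀ w := fun w hw => by simp only [hγ, indicator_of_mem hw]
  have hγc : ∀ w, Continuous (γ w) := fun w => by
    by_cases hw : w ∈ S
    · simpa only [hγS w hw] using continuous_noise hw.1 x₀
    · simpa only [hγ, indicator_of_notMem hw] using continuous_const
  have hγm : ∀ t : ℝ≥0, Measurable[augmentedFiltration P B t] fun w => γ w t := fun t => by
    simp only [hγ, noise, Real.toNNReal_coe]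
    exact Measurable.indicator
      (((measurable_augmentedFiltration t).const_mul _).const_add _) (hSm t)
  obtain ⟨X, hXm, hX⟩ := exists_adapted_solution (monotone_augmentedFiltration (P := P) (B := B))
    ha (locallyLipschitz_neg_deriv hW₁) (fun y hy => congrArg Neg.neg (hK y hy)) hγc hγm hSm
    fun w hw => hγS w hw ▸ hw.2
  refine ⟨fun t w => X w t, hXm, ?_, ?_⟩
  · filter_upwards [hSae] with w hw using (hX w hw).1.continuous.comp NNReal.continuous_coe
  · filter_upwards [hSae] with w hw t
    obtain ⟨hXw, hX0⟩ := hX w hw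
    have hclamp : ∫ s in (0 : ℝ)..t, deriv W₁ (X w s.toNNReal) =
        ∫ s in (0 : ℝ)..t, deriv W₁ (X w s) := intervalIntegral.integral_congr fun s hs => by
      rw [uIcc_of_le t.coe_nonneg] at hs
      simp only [Real.coe_toNNReal _ hs.1]
    have heq := hXw.sub_eq 0 self_mem_Ici t t.2
    rw [hX0, intervalIntegral.integral_neg, hγS w hw] at heq
    simp only [noise, Real.toNNReal_coe] at heq
    linarith

theorem IsStrongSolution.indistinguishable {x₀ : ℝ} {X Y : ℝ≥0 → Ω → ℝ}
    (hX : IsStrongSolution P B W x₀ X) (hY : IsStrongSolution P B W x₀ Y)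
    (hW : ContDiff ℝ ∞ W) : ∀ᵐ w ∂P, ∀ t, X t w = Y t w := by
  have ha := locallyLipschitz_neg_deriv hW
  have hderiv := (contDiff_infty_iff_deriv.1 hW).2.continuous
  filter_upwards [hX.ae_isSolutionOn hderiv, hY.ae_isSolutionOn hderiv, hX.equation, hY.equation]
    with w hXw hYw hXe hYe t
  have h0 : X (0 : ℝ).toNNReal w = Y (0 : ℝ).toNNReal w := by rw [hXe, hYe]; simp
  have hsub : Icc (0 : ℝ) t ⊆ Ici 0 := fun s hs => hs.1
  simpa using (hXw.mono hsub).eqOn_of_eq ha (hYw.mono hsub) h0 ⟨t.2, le_rfl⟩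

end BrownianNoise

theorem hasUniqueStrongSolution_of_deriv_eq {W W₁ : ℝ → ℝ} {K : ℝ} (hW : ContDiff ℝ ∞ W)
    (hW₁ : ContDiff ℝ ∞ W₁) (hK : ∀ y, K ≤ |y| → deriv W₁ y = deriv W y)
    (h : ∀ x₀, HasUniqueStrongSolution W x₀) (x₀ : ℝ) : HasUniqueStrongSolution W₁ x₀ :=
  fun _ _ _ _ _ hB => ⟨exists_isStrongSolution_of_deriv_eq hB hW hW₁ hK h x₀,
    fun _ _ hX hY => hX.indistinguishable hY hW₁⟩

/-! ### Weak derivatives -/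

section WeakDerivatives

variable {φ φ₁ g g₁ ψ : ℝ → ℝ}

theorem continuous_deriv_of_smoothCompact (hψ : ψ ∈ smoothCompact) : Continuous (deriv ψ) :=
  hψ.1.continuous_deriv (by norm_cast)

theorem hasDerivAt_of_smoothCompact (hψ : ψ ∈ smoothCompact) (x : ℝ) :
    HasDerivAt ψ (deriv ψ x) x :=
  (hψ.1.differentiable (by norm_cast)).differentiableAt.hasDerivAt

theorem integrable_mul_of_hasCompactSupport (hφ : LocallyIntegrable φ) (hψ : Continuous ψ)
    (hψc : HasCompactSupport ψ) : Integrable fun x => φ x * ψ x := by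
  simpa only [smul_eq_mul, mul_comm] using hφ.integrable_smul_left_of_hasCompactSupport hψ hψc

theorem integrable_mul_smoothCompact (hφ : LocallyIntegrable φ) (hψ : ψ ∈ smoothCompact) :
    Integrable fun x => φ x * ψ x :=
  integrable_mul_of_hasCompactSupport hφ hψ.1.continuous hψ.2

theorem integrable_mul_deriv_smoothCompact (hφ : LocallyIntegrable φ) (hψ : ψ ∈ smoothCompact) :
    Integrable fun x => φ x * deriv ψ x :=
  integrable_mul_of_hasCompactSupport hφ (continuous_deriv_of_smoothCompact hψ) hψ.2.deriv

theorem hasWeakDeriv_of_hasDerivAt (h : ∀ x, HasDerivAt φ (g x) x) (hg : Continuous g) :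
    HasWeakDeriv φ g := by
  have hφ : Continuous φ := continuous_iff_continuousAt.2 fun x => (h x).continuousAt
  exact ⟨hφ.locallyIntegrable, hg.locallyIntegrable, fun ψ hψ =>
    integral_mul_deriv_eq_deriv_mul_of_integrable (fun x _ => h x)
      (fun x _ => hasDerivAt_of_smoothCompact hψ x)
      (integrable_mul_deriv_smoothCompact hφ.locallyIntegrable hψ)
      (integrable_mul_smoothCompact hg.locallyIntegrable hψ)
      (integrable_mul_smoothCompact hφ.locallyIntegrable hψ)⟩

theorem HasWeakDeriv.sub (h : HasWeakDeriv φ g) (h₁ : HasWeakDeriv φ₁ g₁) :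
    HasWeakDeriv (φ - φ₁) (g - g₁) := by
  refine ⟨h.locallyIntegrable.sub h₁.locallyIntegrable,
    h.locallyIntegrable_deriv.sub h₁.locallyIntegrable_deriv, fun ψ hψ => ?_⟩
  simp only [Pi.sub_apply, sub_mul]
  rw [integral_sub (integrable_mul_deriv_smoothCompact h.locallyIntegrable hψ)
      (integrable_mul_deriv_smoothCompact h₁.locallyIntegrable hψ),
    integral_sub (integrable_mul_smoothCompact h.locallyIntegrable_deriv hψ)
      (integrable_mul_smoothCompact h₁.locallyIntegrable_deriv hψ),
    h.integral_eq ψ hψ, h₁.integral_eq ψ hψ]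
  ring

theorem HasWeakDeriv.sub_const (h : HasWeakDeriv φ g) (c : ℝ) :
    HasWeakDeriv (fun x => φ x - c) g := by
  simpa only [sub_zero] using!
    h.sub (hasWeakDeriv_of_hasDerivAt (g := 0) (fun x => hasDerivAt_const x c) continuous_const)

theorem exists_primitive_smoothCompact (hψ : ψ ∈ smoothCompact) (h0 : ∫ x, ψ x = 0) :
    ∃ η ∈ smoothCompact, deriv η = ψ := by
  obtain ⟨R, -, hψR⟩ := hψ.2.exists_pos_le_norm
  let η : ℝ → ℝ := fun x => ∫ t in (-R)..x, ψ t
  have hη : ∀ x, HasDerivAt η (ψ x) x := fun x =>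
    intervalIntegral.integral_hasDerivAt_right (hψ.1.continuous.intervalIntegrable _ _)
      (hψ.1.continuous.stronglyMeasurableAtFilter _ _) hψ.1.continuous.continuousAt
  have hderiv : deriv η = ψ := funext fun x => (hη x).deriv
  have hsupp : ∀ x ∉ Icc (-R) R, η x = 0 := by
    intro x hx
    rcases lt_or_ge x (-R) with hxR | hxR
    · rw [← intervalIntegral.integral_zero (a := -R) (b := x)]
      refine intervalIntegral.integral_congr fun t ht => hψR t ?_
      rw [uIcc_of_ge hxR.le] at ht
      exact (le_neg.1 ht.2).trans (neg_le_abs t)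
    · have hRx : R < x := not_le.1 fun h => hx ⟨hxR, h⟩
      rw [← h0]
      refine intervalIntegral.integral_eq_integral_of_support_subset fun t ht => ?_
      obtain ⟨hRt, htR⟩ := abs_lt.1 (not_le.1 fun h => ht (hψR t h))
      exact ⟨hRt, (htR.trans hRx).le⟩
  refine ⟨η, ⟨?_, HasCompactSupport.intro isCompact_Icc hsupp⟩, hderiv⟩
  rw [contDiff_infty_iff_deriv, hderiv]
  exact ⟨fun x => (hη x).differentiableAt, hψ.1⟩

/-- The lemma of du Bois-Reymond. -/
theorem exists_ae_eq_const_of_integral_mul_deriv_eq_zero (hφ : LocallyIntegrable φ)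
    (h : ∀ ψ ∈ smoothCompact, ∫ x, φ x * deriv ψ x = 0) : ∃ c : ℝ, ∀ᵐ x, φ x = c := by
  let b : ContDiffBump (0 : ℝ) := ⟨1, 2, one_pos, one_lt_two⟩
  set θ := b.normed volume
  have hθ : θ ∈ smoothCompact := ⟨b.contDiff_normed, b.hasCompactSupport_normed⟩
  have hθ1 : ∫ x, θ x = 1 := b.integral_normed
  refine ⟨∫ x, φ x * θ x, ?_⟩
  set c := ∫ x, φ x * θ x
  have hsub : LocallyIntegrable fun x => φ x - c := hφ.sub continuous_const.locallyIntegrable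
  suffices hae : ∀ᵐ x, φ x - c = 0 by filter_upwards [hae] with x hx using sub_eq_zero.1 hx
  refine ae_eq_zero_of_integral_contDiff_smul_eq_zero hsub fun ψ hψ hψc => ?_
  have hψint : Integrable ψ := hψ.continuous.integrable_of_hasCompactSupport hψc
  have hφψ := integrable_mul_of_hasCompactSupport hφ hψ.continuous hψc
  have hφθ := integrable_mul_smoothCompact hφ hθ
  -- `ψ - (∫ ψ) θ` has integral zero, hence is the derivative of a test function.
  have hcorrected : ∫ x, φ x * (ψ x - (∫ y, ψ y) * θ x) = 0 := by
    obtain ⟨η, hη, hηψ⟩ := exists_primitive_smoothCompact (ψ := fun x => ψ x - (∫ y, ψ y) * θ x)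
      ⟨hψ.sub (contDiff_const.mul hθ.1), hψc.sub hθ.2.mul_left⟩
      (by rw [integral_sub hψint (b.integrable_normed.const_mul _), integral_const_mul, hθ1,
        mul_one, sub_self])
    simpa only [hηψ] using h η hη
  calc ∫ x, ψ x • (φ x - c) = (∫ x, φ x * ψ x) - c * ∫ y, ψ y := by
        rw [← integral_const_mul, ← integral_sub hφψ (hψint.const_mul _)]
        congr with x
        rw [smul_eq_mul]
        ring
    _ = (∫ x, φ x * ψ x) - (∫ y, ψ y) * c := by ring
    _ = ∫ x, φ x * (ψ x - (∫ y, ψ y) * θ x) := by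
        rw [← integral_const_mul, ← integral_sub hφψ (hφθ.const_mul _)]
        congr with x
        ring
    _ = 0 := hcorrected

end WeakDerivatives

/-! ### Poincaré inequality -/

section Poincare

variable {ν ν₁ : Measure ℝ} {φ φ₁ g g₁ : ℝ → ℝ}

theorem MemH1.sub (h : MemH1 ν φ g) (h₁ : MemH1 ν φ₁ g₁) : MemH1 ν (φ - φ₁) (g - g₁) :=
  ⟨h.hasWeakDeriv.sub h₁.hasWeakDeriv, h.memLp.sub h₁.memLp, h.memLp_deriv.sub h₁.memLp_deriv⟩

theorem MemH1.sub_const [IsFiniteMeasure ν] (h : MemH1 ν φ g) (c : ℝ) :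
    MemH1 ν (fun x => φ x - c) g :=
  ⟨h.hasWeakDeriv.sub_const c, h.memLp.sub (memLp_const c), h.memLp_deriv⟩

theorem MemH1.of_measure_le_smul {c : ℝ≥0} (hle : ν₁ ≤ c • ν) (h : MemH1 ν φ g) :
    MemH1 ν₁ φ g :=
  ⟨h.hasWeakDeriv, h.memLp.of_measure_le_smul ENNReal.coe_ne_top hle,
    h.memLp_deriv.of_measure_le_smul ENNReal.coe_ne_top hle⟩

theorem satisfiesPoincare_iff_variance_le [IsProbabilityMeasure ν] :
    SatisfiesPoincare ν ↔
      ∃ C : ℝ, 0 < C ∧ ∀ φ g, MemH1 ν φ g → Var[φ; ν] ≤ C * ∫ x, g x ^ 2 ∂ν := by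
  constructor
  · rintro ⟨R, hR, h⟩
    refine ⟨1 / R, one_div_pos.2 hR, fun φ g hφ => ?_⟩
    rw [variance_eq_integral hφ.memLp.aemeasurable]
    refine h _ g (hφ.sub_const _) ?_
    rw [integral_sub (hφ.memLp.integrable one_le_two) (integrable_const _), integral_const,
      probReal_univ, one_smul, sub_self]
  · rintro ⟨C, hC, h⟩
    refine ⟨1 / C, one_div_pos.2 hC, fun φ g hφ hφ0 => ?_⟩
    rw [one_div_one_div, ← variance_of_integral_eq_zero hφ.memLp.aemeasurable hφ0]
    exact h φ g hφ

theorem variance_le_integral_sub_sq [IsProbabilityMeasure ν] (hφ : AEStronglyMeasurable φ ν)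
    (c : ℝ) : Var[φ; ν] ≤ ∫ x, (φ x - c) ^ 2 ∂ν := by
  rw [← variance_sub_const hφ c]
  exact variance_le_expectation_sq (hφ.sub aestronglyMeasurable_const)

theorem integral_le_mul_of_measure_le_smul {c : ℝ≥0} (hle : ν₁ ≤ c • ν) (hφ : Integrable φ ν)
    (h0 : 0 ≤ φ) : ∫ x, φ x ∂ν₁ ≤ c * ∫ x, φ x ∂ν := by
  rw [← smul_eq_mul, ← NNReal.smul_def, ← integral_smul_nnreal_measure]
  exact integral_mono_measure hle (.of_forall h0) (hφ.smul_measure ENNReal.coe_ne_top)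

/-- The perturbation principle of Holley and Stroock. -/
theorem SatisfiesPoincare.of_measure_le_smul [IsProbabilityMeasure ν] [IsProbabilityMeasure ν₁]
    {c c₁ : ℝ≥0} (h : SatisfiesPoincare ν) (hle : ν₁ ≤ c • ν) (hle₁ : ν ≤ c₁ • ν₁) :
    SatisfiesPoincare ν₁ := by
  obtain ⟨C, hC, hvar⟩ := satisfiesPoincare_iff_variance_le.1 h
  refine satisfiesPoincare_iff_variance_le.2
    ⟨c * (C * c₁) + 1, by positivity, fun φ g hφ => ?_⟩
  have hφν := hφ.of_measure_le_smul hle₁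
  calc Var[φ; ν₁] ≤ ∫ x, (φ x - ν[φ]) ^ 2 ∂ν₁ := variance_le_integral_sub_sq hφ.memLp.1 _
    _ ≤ c * ∫ x, (φ x - ν[φ]) ^ 2 ∂ν := integral_le_mul_of_measure_le_smul hle
        (hφν.sub_const _).memLp.integrable_sq fun x => sq_nonneg _
    _ = c * Var[φ; ν] := by rw [variance_eq_integral hφν.memLp.aemeasurable]
    _ ≤ c * (C * ∫ x, g x ^ 2 ∂ν) := by gcongr; exact hvar φ g hφν
    _ ≤ c * (C * (c₁ * ∫ x, g x ^ 2 ∂ν₁)) := by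
        gcongr
        exact integral_le_mul_of_measure_le_smul hle₁ hφ.memLp_deriv.integrable_sq
          fun x => sq_nonneg _
    _ ≤ (c * (C * c₁) + 1) * ∫ x, g x ^ 2 ∂ν₁ := by
        have : 0 ≤ ∫ x, g x ^ 2 ∂ν₁ := integral_nonneg fun x => sq_nonneg _
        linarith

end Poincare

/-! ### Gibbs measures -/

section Gibbs

variable {W U : ℝ → ℝ}

theorem partition_pos (hW : Integrable fun x => Real.exp (-W x)) : 0 < partition W :=
  integral_exp_pos hW

theorem isProbabilityMeasure_gibbs (hW : Integrable fun x => Real.exp (-W x)) :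
    IsProbabilityMeasure (gibbs W) :=
  isProbabilityMeasure_tilted hW

theorem integral_gibbs (W g : ℝ → ℝ) :
    ∫ x, g x ∂(gibbs W) = (∫ x, g x * Real.exp (-W x)) / partition W := by
  rw [gibbs, integral_tilted, ← integral_div]
  congr with x
  rw [smul_eq_mul, partition]
  ring

theorem integrable_gibbs_iff (hW : Integrable fun x => Real.exp (-W x)) (g : ℝ → ℝ) :
    Integrable g (gibbs W) ↔ Integrable fun x => g x * Real.exp (-W x) := by
  rw [gibbs, integrable_tilted_iff hW]
  simp only [smul_eq_mul, mul_comm]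

theorem gibbs_absolutelyContinuous (W : ℝ → ℝ) : gibbs W ≪ volume :=
  tilted_absolutelyContinuous _ _

theorem absolutelyContinuous_gibbs (hW : Integrable fun x => Real.exp (-W x)) :
    volume ≪ gibbs W :=
  absolutelyContinuous_tilted hW

theorem gibbs_add_eq_tilted (hW : Integrable fun x => Real.exp (-W x)) (U : ℝ → ℝ) :
    gibbs (W + U) = (gibbs W).tilted (-U) := by
  rw [gibbs, gibbs, tilted_tilted hW]
  congr with x
  exact neg_add _ _

theorem integrable_exp_neg_add (hW : Integrable fun x => Real.exp (-W x)) (hU : Continuous U)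
    {C : ℝ} (hC : ∀ x, |U x| ≤ C) : Integrable fun x => Real.exp (-(W + U) x) := by
  simp only [Pi.add_apply, neg_add, Real.exp_add]
  refine hW.mul_bdd (c := Real.exp C) (by fun_prop : Continuous _).aestronglyMeasurable
    (.of_forall fun x => ?_)
  rw [Real.norm_eq_abs, Real.abs_exp, Real.exp_le_exp]
  exact (neg_le_abs _).trans (hC x)

theorem tilted_le_smul {α : Type*} [MeasurableSpace α] {ν : Measure α} [IsProbabilityMeasure ν]
    {u : α → ℝ} (hu : AEMeasurable u ν) {C : ℝ} (hC : ∀ x, |u x| ≤ C) :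
    ν.tilted u ≤ (Real.exp (2 * C)).toNNReal • ν := by
  have hint : Integrable (fun x => Real.exp (u x)) ν :=
    .of_bound (Real.measurable_exp.comp_aemeasurable hu).aestronglyMeasurable (Real.exp C)
      (.of_forall fun x => by simpa using (le_abs_self _).trans (hC x))
  have hpartition : Real.exp (-C) ≤ ∫ x, Real.exp (u x) ∂ν := by
    simpa using integral_mono (integrable_const (Real.exp (-C))) hint
      fun x => Real.exp_le_exp.2 (abs_le.1 (hC x)).1
  have hdensity : ∀ x, Real.exp (u x) / ∫ y, Real.exp (u y) ∂ν ≤ Real.exp (2 * C) := by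
    intro x
    rw [div_le_iff₀ ((Real.exp_pos _).trans_le hpartition)]
    calc Real.exp (u x) ≤ Real.exp C := Real.exp_le_exp.2 ((le_abs_self _).trans (hC x))
      _ = Real.exp (2 * C) * Real.exp (-C) := by rw [← Real.exp_add]; ring_nf
      _ ≤ _ := by gcongr
  calc ν.tilted u ≤ ν.withDensity fun _ => ENNReal.ofReal (Real.exp (2 * C)) :=
        withDensity_mono (.of_forall fun x => ENNReal.ofReal_le_ofReal (hdensity x))
    _ = (Real.exp (2 * C)).toNNReal • ν := withDensity_const _

theorem gibbs_add_le_smul (hW : Integrable fun x => Real.exp (-W x)) (hU : Continuous U) {C : ℝ}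
    (hC : ∀ x, |U x| ≤ C) : gibbs (W + U) ≤ (Real.exp (2 * C)).toNNReal • gibbs W := by
  have := isProbabilityMeasure_gibbs hW
  rw [gibbs_add_eq_tilted hW]
  exact tilted_le_smul hU.neg.aemeasurable fun x => (abs_neg _).trans_le (hC x)

theorem gibbs_le_smul_gibbs_add (hW : Integrable fun x => Real.exp (-W x)) (hU : Continuous U)
    {C : ℝ} (hC : ∀ x, |U x| ≤ C) :
    gibbs W ≤ (Real.exp (2 * C)).toNNReal • gibbs (W + U) := by
  simpa using gibbs_add_le_smul (integrable_exp_neg_add hW hU hC) hU.neg (C := C)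
    fun x => (abs_neg _).trans_le (hC x)

theorem SatisfiesPoincare.gibbs_add (hW : Integrable fun x => Real.exp (-W x))
    (h : SatisfiesPoincare (gibbs W)) (hU : Continuous U) {C : ℝ} (hC : ∀ x, |U x| ≤ C) :
    SatisfiesPoincare (gibbs (W + U)) :=
  have := isProbabilityMeasure_gibbs hW
  have := isProbabilityMeasure_gibbs (integrable_exp_neg_add hW hU hC)
  h.of_measure_le_smul (gibbs_add_le_smul hW hU hC) (gibbs_le_smul_gibbs_add hW hU hC)

end Gibbs

section Admissible

variable {V f U : ℝ → ℝ}

theorem IsAdmissible.integrable_exp_neg (h0 : IsAdmissible V f 0) :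
    Integrable fun x => Real.exp (-V x) := by
  simpa using h0.integrable

theorem isAdmissible_of_smoothCompact (hV : ContDiff ℝ ∞ V) (h0 : IsAdmissible V f 0)
    (hU : U ∈ smoothCompact) : IsAdmissible V f U := by
  obtain ⟨C, hC⟩ := hU.2.exists_bound_of_continuous hU.1.continuous
  have hUc := hU.1.continuous
  refine ⟨hU.1, integrable_exp_neg_add h0.integrable_exp_neg hUc hC, ?_, ?_, fun x₀ => ?_⟩
  · exact SatisfiesPoincare.gibbs_add h0.integrable_exp_neg (by simpa using h0.poincare) hUc hC
  · have hcentered : MemLp (fun x => f x - mean V f) 2 (gibbs (V + U)) :=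
      (by simpa using h0.memLp : MemLp (fun x => f x - mean V f) 2 (gibbs V)).of_measure_le_smul
        ENNReal.coe_ne_top (gibbs_add_le_smul h0.integrable_exp_neg hUc hC)
    refine hcentered.of_le_mul (c := Real.exp C)
      (hcentered.1.mul (by fun_prop : Continuous _).aestronglyMeasurable) (.of_forall fun x => ?_)
    rw [norm_mul, mul_comm, Real.norm_of_nonneg (Real.exp_pos _).le]
    gcongr
    exact (le_abs_self _).trans (hC x)
  · obtain ⟨R, -, hR⟩ := hU.2.deriv.exists_pos_le_norm
    refine hasUniqueStrongSolution_of_deriv_eq hV (hV.add hU.1) (K := R) (fun y hy => ?_)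
      (by simpa using h0.strongSolution) x₀
    rw [deriv_fun_add (hV.differentiable (by norm_cast)).differentiableAt
      (hU.1.differentiable (by norm_cast)).differentiableAt, hR y hy, add_zero]

theorem smoothCompact_subset_admissible {J : ℕ} {f : Fin J → ℝ → ℝ} (hV : ContDiff ℝ ∞ V)
    (h0 : (0 : ℝ → ℝ) ∈ admissible V f) : smoothCompact ⊆ admissible V f :=
  fun _ hU j => isAdmissible_of_smoothCompact hV (h0 j) hU

end Admissible

/-! ### Consequences of the Poincaré inequality -/

theorem integrable_of_tendsto_of_integral_le {α : Type*} [MeasurableSpace α] {ν : Measure α}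
    {G : ℕ → α → ℝ} {g : α → ℝ} {C : ℝ} (hG : ∀ n, Integrable (G n) ν) (hG0 : ∀ n, 0 ≤ G n)
    (hC : ∀ n, ∫ x, G n x ∂ν ≤ C) (hlim : ∀ x, Tendsto (fun n => G n x) atTop (𝓝 (g x))) :
    Integrable g ν := by
  refine ⟨aestronglyMeasurable_of_tendsto_ae _ (fun n => (hG n).1) (.of_forall hlim), ?_⟩
  have hbound : ∀ n, ∫⁻ x, ‖G n x‖ₑ ∂ν ≤ ENNReal.ofReal C := fun n => by
    rw [← ofReal_integral_norm_eq_lintegral_enorm (hG n)]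
    simpa only [Real.norm_of_nonneg (hG0 n _)] using ENNReal.ofReal_le_ofReal (hC n)
  calc ∫⁻ x, ‖g x‖ₑ ∂ν = ∫⁻ x, liminf (fun n => ‖G n x‖ₑ) atTop ∂ν := by
        simp only [(hlim _).enorm.liminf_eq]
    _ ≤ liminf (fun n => ∫⁻ x, ‖G n x‖ₑ ∂ν) atTop :=
        lintegral_liminf_le' fun n => (hG n).1.aemeasurable.enorm
    _ ≤ ENNReal.ofReal C :=
        liminf_le_of_frequently_le' (Eventually.of_forall hbound).frequently
    _ < ⊤ := ENNReal.ofReal_lt_top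

/-- A sequence of smooth cutoffs, equal to `1` on `[-n - 1, n + 1]`. -/
noncomputable def cutoff (n : ℕ) : ContDiffBump (0 : ℝ) := ⟨n + 1, n + 2, by positivity, by simp⟩

theorem cutoff_eq_one {n : ℕ} {x : ℝ} (h : |x| ≤ n) : cutoff n x = 1 := by
  refine (cutoff n).one_of_mem_closedBall (mem_closedBall_zero_iff.2 ?_)
  exact h.trans (lt_add_one _).le

theorem eventually_cutoff_eq_one (R : ℝ) : ∀ᶠ n in atTop, ∀ x, |x| ≤ R → cutoff n x = 1 := by
  filter_upwards [tendsto_natCast_atTop_atTop.eventually_ge_atTop R] with n hn x hx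
  exact cutoff_eq_one (hx.trans hn)

theorem tendsto_mul_cutoff (a x : ℝ) : Tendsto (fun n => a * cutoff n x) atTop (𝓝 a) := by
  refine tendsto_const_nhds.congr' ?_
  filter_upwards [eventually_cutoff_eq_one |x|] with n hn
  rw [hn x le_rfl, mul_one]

theorem tendsto_intervalIntegral_mul_cutoff (g : ℝ → ℝ) (x : ℝ) :
    Tendsto (fun n => ∫ t in (0 : ℝ)..x, g t * cutoff n t) atTop (𝓝 (∫ t in (0 : ℝ)..x, g t)) := by
  refine tendsto_const_nhds.congr' ?_
  filter_upwards [eventually_cutoff_eq_one |x|] with n hn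
  refine intervalIntegral.integral_congr fun t ht => ?_
  have htx : |t| ≤ |x| := by simpa using abs_sub_left_of_mem_uIcc ht
  rw [hn t htx, mul_one]

theorem hasDerivAt_primitive {g : ℝ → ℝ} (hg : Continuous g) (x : ℝ) :
    HasDerivAt (fun x => ∫ t in (0 : ℝ)..x, g t) (g x) x :=
  intervalIntegral.integral_hasDerivAt_right (hg.intervalIntegrable _ _)
    (hg.stronglyMeasurableAtFilter _ _) hg.continuousAt

section Poincare

variable {ν : Measure ℝ} {Φ g h r : ℝ → ℝ}

theorem exists_abs_le_of_hasDerivAt (hΦ : ∀ x, HasDerivAt Φ (g x) x) (hg : Continuous g)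
    (hgc : HasCompactSupport g) : ∃ C, ∀ x, |Φ x| ≤ C := by
  refine ⟨|Φ 0| + ∫ t, |g t|, fun x => ?_⟩
  rw [← add_sub_cancel (Φ 0) (Φ x), ← intervalIntegral.integral_eq_sub_of_hasDerivAt
    (fun t _ => hΦ t) (hg.intervalIntegrable 0 x)]
  refine (abs_add_le _ _).trans (add_le_add_right ?_ _)
  exact intervalIntegral.norm_integral_le_integral_norm_uIoc.trans
    (setIntegral_le_integral (hg.integrable_of_hasCompactSupport hgc).norm
      (.of_forall fun t => norm_nonneg _))

theorem memH1_of_hasDerivAt [IsFiniteMeasure ν] (hΦ : ∀ x, HasDerivAt Φ (g x) x)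
    (hg : Continuous g) (hgc : HasCompactSupport g) : MemH1 ν Φ g := by
  obtain ⟨C, hC⟩ := exists_abs_le_of_hasDerivAt hΦ hg hgc
  obtain ⟨D, hD⟩ := hgc.exists_bound_of_continuous hg
  have hΦc : Continuous Φ := continuous_iff_continuousAt.2 fun x => (hΦ x).continuousAt
  exact ⟨hasWeakDeriv_of_hasDerivAt hΦ hg, .of_bound hΦc.aestronglyMeasurable C (.of_forall hC),
    .of_bound hg.aestronglyMeasurable D (.of_forall hD)⟩

theorem two_mul_covariance_le [IsFiniteMeasure ν] (hr : MemLp r 2 ν) (hΦ : MemLp Φ 2 ν) (C : ℝ) :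
    2 * C * cov[r, Φ; ν] ≤ C ^ 2 * Var[r; ν] + Var[Φ; ν] := by
  have := variance_nonneg (C • r - Φ) ν
  rw [variance_sub (hr.const_smul C) hΦ, variance_smul, covariance_smul_left] at this
  linarith

/-- The a priori energy estimate for the weak equation `∫ h ψ' ∂ν = cov[r, ψ]`, tested with a
primitive of `h` times a cutoff. -/
theorem integral_sq_mul_cutoff_le [IsProbabilityMeasure ν] {C : ℝ} (hC : 0 < C)
    (hvar : ∀ φ g, MemH1 ν φ g → Var[φ; ν] ≤ C * ∫ x, g x ^ 2 ∂ν) (hh : Continuous h)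
    (hr : MemLp r 2 ν)
    (hweak : ∀ ψ g, (∀ x, HasDerivAt ψ (g x) x) → Continuous g → HasCompactSupport g →
      ∫ x, h x * g x ∂ν = cov[r, ψ; ν]) (n : ℕ) :
    ∫ x, h x ^ 2 * cutoff n x ∂ν ≤ C * Var[r; ν] := by
  have hχ : Continuous (cutoff n) := (cutoff n).continuous
  let g := fun x => h x * cutoff n x
  have hg : Continuous g := hh.mul hχ
  have hgc : HasCompactSupport g := (cutoff n).hasCompactSupport.mul_left
  let ψ := fun x => ∫ t in (0 : ℝ)..x, g t
  have hψ : ∀ x, HasDerivAt ψ (g x) x := hasDerivAt_primitive hg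
  have hψν : MemH1 ν ψ g := memH1_of_hasDerivAt hψ hg hgc
  have hint : Integrable (fun x => h x ^ 2 * cutoff n x) ν :=
    ((hh.pow 2).mul hχ).integrable_of_hasCompactSupport (cutoff n).hasCompactSupport.mul_left
  have henergy : ∫ x, h x ^ 2 * cutoff n x ∂ν = cov[r, ψ; ν] := by
    rw [← hweak ψ g hψ hg hgc]
    congr with x
    ring
  have hsq : ∫ x, g x ^ 2 ∂ν ≤ ∫ x, h x ^ 2 * cutoff n x ∂ν := by
    refine integral_mono hψν.memLp_deriv.integrable_sq hint fun x => ?_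
    have hχ0 := (cutoff n).nonneg' x
    have hχ1 : cutoff n x ^ 2 ≤ cutoff n x := pow_le_of_le_one hχ0 (cutoff n).le_one two_ne_zero
    calc g x ^ 2 = h x ^ 2 * cutoff n x ^ 2 := mul_pow _ _ _
      _ ≤ h x ^ 2 * cutoff n x := by gcongr
  have hyoung := two_mul_covariance_le hr hψν.memLp C
  have hpoincare := hvar ψ g hψν
  rw [← henergy] at hyoung
  refine le_of_mul_le_mul_left ?_ hC
  nlinarith [mul_le_mul_of_nonneg_left hsq hC.le]

theorem memLp_two_of_weak_poisson [IsProbabilityMeasure ν] (hP : SatisfiesPoincare ν)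
    (hh : Continuous h) (hr : MemLp r 2 ν)
    (hweak : ∀ ψ g, (∀ x, HasDerivAt ψ (g x) x) → Continuous g → HasCompactSupport g →
      ∫ x, h x * g x ∂ν = cov[r, ψ; ν]) : MemLp h 2 ν := by
  obtain ⟨C, hC, hvar⟩ := satisfiesPoincare_iff_variance_le.1 hP
  refine (memLp_two_iff_integrable_sq hh.aestronglyMeasurable).2 ?_
  refine integrable_of_tendsto_of_integral_le (G := fun n x => h x ^ 2 * cutoff n x)
    (fun n => ?_) (fun n x => mul_nonneg (sq_nonneg _) ((cutoff n).nonneg' x))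
    (integral_sq_mul_cutoff_le hC hvar hh hr hweak) fun x => tendsto_mul_cutoff _ x
  exact ((hh.pow 2).mul (cutoff n).continuous).integrable_of_hasCompactSupport
    (cutoff n).hasCompactSupport.mul_left

theorem integral_prod_sub_sq [IsProbabilityMeasure ν] (hΦ : MemLp Φ 2 ν) :
    ∫ p, (Φ p.1 - Φ p.2) ^ 2 ∂(ν.prod ν) = 2 * Var[Φ; ν] := by
  have hfst := hΦ.comp_fst ν
  have hsnd := hΦ.comp_snd ν
  have hmean : ∫ p, (Φ p.1 - Φ p.2) ∂(ν.prod ν) = 0 := by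
    rw [integral_sub (hfst.integrable one_le_two) (hsnd.integrable one_le_two),
      integral_fun_fst, integral_fun_snd, sub_self]
  have hsq := variance_of_integral_eq_zero (X := fun p : ℝ × ℝ => Φ p.1 - Φ p.2)
    (hfst.sub hsnd).aemeasurable hmean
  have hadd := variance_add_prod hΦ hΦ.neg
  rw [variance_neg] at hadd
  rw [← hsq, two_mul, ← hadd]
  simp only [sub_eq_add_neg, Pi.neg_apply]

/-- A primitive of a continuous function of `L²(ν)` is in `L²(ν)`: by Fatou's lemma, the
differences `Φ x - Φ y` are in `L²(ν ⊗ ν)`, where no mean has to be controlled. -/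
theorem SatisfiesPoincare.memLp_two_of_hasDerivAt [IsProbabilityMeasure ν]
    (hP : SatisfiesPoincare ν) (hΦ : ∀ x, HasDerivAt Φ (g x) x) (hg : Continuous g)
    (hg2 : MemLp g 2 ν) : MemLp Φ 2 ν := by
  obtain ⟨C, hC, hvar⟩ := satisfiesPoincare_iff_variance_le.1 hP
  let Ψ : ℕ → ℝ → ℝ := fun n x => ∫ t in (0 : ℝ)..x, g t * cutoff n t
  have hΨ : ∀ n, MemH1 ν (Ψ n) fun t => g t * cutoff n t := fun n =>
    have hgχ : Continuous fun t => g t * cutoff n t := hg.mul (cutoff n).continuous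
    memH1_of_hasDerivAt (hasDerivAt_primitive hgχ) hgχ (cutoff n).hasCompactSupport.mul_left
  have hΨlim : ∀ x, Tendsto (fun n => Ψ n x) atTop (𝓝 (Φ x - Φ 0)) := fun x => by
    rw [← intervalIntegral.integral_eq_sub_of_hasDerivAt (fun t _ => hΦ t)
      (hg.intervalIntegrable 0 x)]
    exact tendsto_intervalIntegral_mul_cutoff g x
  have hΨvar : ∀ n, Var[Ψ n; ν] ≤ C * ∫ x, g x ^ 2 ∂ν := fun n => by
    refine (hvar _ _ (hΨ n)).trans ?_
    gcongr ?_ * ?_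
    refine integral_mono (hΨ n).memLp_deriv.integrable_sq hg2.integrable_sq fun x => ?_
    change (g x * cutoff n x) ^ 2 ≤ g x ^ 2
    rw [mul_pow]
    exact mul_le_of_le_one_right (sq_nonneg _)
      (pow_le_one₀ ((cutoff n).nonneg' x) (cutoff n).le_one)
  have hprod : Integrable (fun p : ℝ × ℝ => (Φ p.1 - Φ p.2) ^ 2) (ν.prod ν) := by
    refine integrable_of_tendsto_of_integral_le (G := fun n p => (Ψ n p.1 - Ψ n p.2) ^ 2)
      (C := 2 * (C * ∫ x, g x ^ 2 ∂ν))
      (fun n => (((hΨ n).memLp.comp_fst ν).sub ((hΨ n).memLp.comp_snd ν)).integrable_sq)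
      (fun n p => sq_nonneg _) (fun n => ?_) fun p => ?_
    · rw [integral_prod_sub_sq (hΨ n).memLp]
      linarith [hΨvar n]
    · simpa using ((hΨlim p.1).sub (hΨlim p.2)).pow 2
  obtain ⟨y, hy⟩ := hprod.prod_left_ae.exists
  have hΦc : Continuous Φ := continuous_iff_continuousAt.2 fun x => (hΦ x).continuousAt
  have hsub : MemLp (fun x => Φ x - Φ y) 2 ν :=
    (memLp_two_iff_integrable_sq (hΦc.sub continuous_const).aestronglyMeasurable).2 hy
  refine (hsub.add (memLp_const (Φ y))).congr_norm hΦc.aestronglyMeasurable (.of_forall fun x => ?_)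
  rw [Pi.add_apply, sub_add_cancel]

end Poincare

/-! ### Poisson equation -/

/-- The function `F - A_ℝ`, that is, `x ↦ ∫_{-∞}^x (f - μ(f)) exp (-V)`. -/
noncomputable def flux (V f : ℝ → ℝ) (x : ℝ) : ℝ := primitiveF V f x - constA V f

section Flux

variable {V f : ℝ → ℝ}

theorem integrable_flux_density (hVint : Integrable fun x => Real.exp (-V x))
    (hfint : Integrable f (gibbs V)) :
    Integrable fun x => (f x - mean V f) * Real.exp (-V x) := by
  simp only [sub_mul]
  exact ((integrable_gibbs_iff hVint f).1 hfint).sub (hVint.const_mul _)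

theorem integral_flux_density (hVint : Integrable fun x => Real.exp (-V x))
    (hfint : Integrable f (gibbs V)) : ∫ x, (f x - mean V f) * Real.exp (-V x) = 0 := by
  simp only [sub_mul]
  rw [integral_sub ((integrable_gibbs_iff hVint f).1 hfint) (hVint.const_mul _),
    integral_const_mul, mean, integral_gibbs, ← partition,
    div_mul_cancel₀ _ (partition_pos hVint).ne', sub_self]

theorem hasDerivAt_flux (hV : Continuous V) (hf : Continuous f) (x : ℝ) :
    HasDerivAt (flux V f) ((f x - mean V f) * Real.exp (-V x)) x :=
  (hasDerivAt_primitive (g := fun x => (f x - mean V f) * Real.exp (-V x))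
    (by fun_prop) x).sub_const _

theorem continuous_flux (hV : Continuous V) (hf : Continuous f) : Continuous (flux V f) :=
  continuous_iff_continuousAt.2 fun x => (hasDerivAt_flux hV hf x).continuousAt

theorem flux_eq_setIntegral (hVint : Integrable fun x => Real.exp (-V x))
    (hfint : Integrable f (gibbs V)) (x : ℝ) :
    flux V f x = ∫ ξ in Iic x, (f ξ - mean V f) * Real.exp (-V ξ) := by
  have h := integrable_flux_density hVint hfint
  rw [flux, primitiveF, constA,
    ← intervalIntegral.integral_Iic_sub_Iic h.integrableOn h.integrableOn]
  ring

theorem tendsto_flux_atBot (hVint : Integrable fun x => Real.exp (-V x))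
    (hfint : Integrable f (gibbs V)) : Tendsto (flux V f) atBot (𝓝 0) := by
  rw [funext (flux_eq_setIntegral hVint hfint)]
  exact tendsto_integral_Iic_zero tendsto_id

theorem tendsto_flux_atTop (hVint : Integrable fun x => Real.exp (-V x))
    (hfint : Integrable f (gibbs V)) : Tendsto (flux V f) atTop (𝓝 0) := by
  have h := integrable_flux_density hVint hfint
  have hsplit := intervalIntegral.integral_Iic_add_Ioi (b := (0 : ℝ)) h.integrableOn h.integrableOn
  rw [integral_flux_density hVint hfint] at hsplit
  have hlim := (intervalIntegral_tendsto_integral_Ioi 0 h.integrableOn tendsto_id).sub_const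
    (constA V f)
  rwa [constA, sub_neg_eq_add, add_comm, hsplit] at hlim

theorem integral_flux_mul_eq_neg (hV : Continuous V)
    (hVint : Integrable fun x => Real.exp (-V x)) (hf : Continuous f)
    (hfint : Integrable f (gibbs V)) {ψ g : ℝ → ℝ} (hψ : ∀ x, HasDerivAt ψ (g x) x)
    (hg : Continuous g) (hgc : HasCompactSupport g) :
    ∫ x, flux V f x * g x = -∫ x, (f x - mean V f) * Real.exp (-V x) * ψ x := by
  obtain ⟨C, hC⟩ := exists_abs_le_of_hasDerivAt hψ hg hgc
  have hψc : Continuous ψ := continuous_iff_continuousAt.2 fun x => (hψ x).continuousAt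
  rw [integral_mul_deriv_eq_deriv_mul (fun x _ => hasDerivAt_flux hV hf x) (fun x _ => hψ x)
    (integrable_mul_of_hasCompactSupport (continuous_flux hV hf).locallyIntegrable hg hgc)
    ((integrable_flux_density hVint hfint).mul_bdd hψc.aestronglyMeasurable (.of_forall hC))
    ((tendsto_flux_atBot hVint hfint).zero_mul_isBoundedUnder_le (isBoundedUnder_of ⟨C, hC⟩))
    ((tendsto_flux_atTop hVint hfint).zero_mul_isBoundedUnder_le (isBoundedUnder_of ⟨C, hC⟩)),
    sub_zero, zero_sub]

end Flux

/-- The derivative of the solution of the Poisson equation, which is obtained by integrating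
`- (exp (- V - U) φ')' = (f - μ(f)) exp (-V)` once, from `-∞`. -/
noncomputable def poissonGradient (V U f : ℝ → ℝ) (x : ℝ) : ℝ :=
  -(flux V f x * Real.exp ((V + U) x))

section PoissonEquation

variable {V U W f g ψ : ℝ → ℝ}

theorem exp_mul_exp_neg_add (V U : ℝ → ℝ) (x : ℝ) :
    Real.exp (U x) * Real.exp (-(V + U) x) = Real.exp (-V x) := by
  rw [← Real.exp_add, Pi.add_apply, neg_add_rev, add_neg_cancel_left]

theorem integral_exp_mul_gibbs_add (V U g : ℝ → ℝ) :
    ∫ x, g x * Real.exp (U x) ∂(gibbs (V + U)) =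
      (∫ x, g x * Real.exp (-V x)) / partition (V + U) := by
  simp only [integral_gibbs, mul_assoc, exp_mul_exp_neg_add]

theorem integral_poissonGradient_mul_gibbs (V U f g : ℝ → ℝ) :
    ∫ x, poissonGradient V U f x * g x ∂(gibbs (V + U)) =
      -(∫ x, flux V f x * g x) / partition (V + U) := by
  rw [integral_gibbs, ← integral_neg]
  congr! 3 with x
  rw [poissonGradient, Real.exp_neg]
  field_simp

theorem continuous_poissonGradient (hV : Continuous V) (hU : Continuous U) (hf : Continuous f) :
    Continuous (poissonGradient V U f) :=
  ((continuous_flux hV hf).mul (hV.add hU).rexp).neg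

theorem integral_poissonGradient_mul (hV : Continuous V)
    (hVint : Integrable fun x => Real.exp (-V x)) (hf : Continuous f)
    (hfint : Integrable f (gibbs V)) (hψ : ∀ x, HasDerivAt ψ (g x) x) (hg : Continuous g)
    (hgc : HasCompactSupport g) :
    ∫ x, poissonGradient V U f x * g x ∂(gibbs (V + U)) =
      ∫ x, (f x - mean V f) * Real.exp (U x) * ψ x ∂(gibbs (V + U)) := by
  rw [integral_poissonGradient_mul_gibbs,
    integral_flux_mul_eq_neg hV hVint hf hfint hψ hg hgc, neg_neg]
  simp only [mul_right_comm _ _ (ψ _), integral_exp_mul_gibbs_add]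

theorem memLp_poissonGradient (hV : Continuous V) (hVint : Integrable fun x => Real.exp (-V x))
    (hf : Continuous f) (hfint : Integrable f (gibbs V)) (hU : IsAdmissible V f U) :
    MemLp (poissonGradient V U f) 2 (gibbs (V + U)) := by
  have := isProbabilityMeasure_gibbs hU.integrable
  refine memLp_two_of_weak_poisson hU.poincare
    (continuous_poissonGradient hV hU.smooth.continuous hf) hU.memLp fun ψ g hψ hg hgc => ?_
  rw [covariance_eq_sub hU.memLp (memH1_of_hasDerivAt hψ hg hgc).memLp,
    integral_exp_mul_gibbs_add V U fun x => f x - mean V f, integral_flux_density hVint hfint,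
    zero_div, zero_mul, sub_zero]
  exact integral_poissonGradient_mul hV hVint hf hfint hψ hg hgc

theorem exists_isPoissonSolution (hV : Continuous V)
    (hVint : Integrable fun x => Real.exp (-V x)) (hf : Continuous f)
    (hfint : Integrable f (gibbs V)) (hU : IsAdmissible V f U) :
    ∃ φ, IsPoissonSolution V U f φ (poissonGradient V U f) := by
  have := isProbabilityMeasure_gibbs hU.integrable
  have hg := continuous_poissonGradient hV hU.smooth.continuous hf
  have hg2 := memLp_poissonGradient hV hVint hf hfint hU
  let Φ : ℝ → ℝ := fun x => ∫ t in (0 : ℝ)..x, poissonGradient V U f t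
  have hΦ : ∀ x, HasDerivAt Φ (poissonGradient V U f x) x := hasDerivAt_primitive hg
  have hΦ2 : MemLp Φ 2 (gibbs (V + U)) := hU.poincare.memLp_two_of_hasDerivAt hΦ hg hg2
  refine ⟨fun x => Φ x - ∫ y, Φ y ∂(gibbs (V + U)),
    MemH1.sub_const ⟨hasWeakDeriv_of_hasDerivAt hΦ hg, hΦ2, hg2⟩ _, ?_, fun ψ hψ => ?_⟩
  · rw [integral_sub (hΦ2.integrable one_le_two) (integrable_const _), integral_const,
      probReal_univ, one_smul, sub_self]
  · exact integral_poissonGradient_mul hV hVint hf hfint (hasDerivAt_of_smoothCompact hψ)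
      (continuous_deriv_of_smoothCompact hψ) hψ.2.deriv

theorem ae_eq_zero_of_integral_mul_deriv_gibbs_eq_zero
    (hW : Integrable fun x => Real.exp (-W x)) (hg : Integrable g (gibbs W))
    (h : ∀ ψ ∈ smoothCompact, ∫ x, g x * deriv ψ x ∂(gibbs W) = 0) : g =ᵐ[volume] 0 := by
  have hgW := (integrable_gibbs_iff hW g).1 hg
  obtain ⟨c, hc⟩ := exists_ae_eq_const_of_integral_mul_deriv_eq_zero hgW.locallyIntegrable
    fun ψ hψ => by
      simpa only [integral_gibbs, div_eq_zero_iff, (partition_pos hW).ne', or_false,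
        mul_right_comm] using h ψ hψ
  have hc0 : c = 0 :=
    (integrable_const_iff.1 (hgW.congr hc)).resolve_right fun h => by
      simpa using h.measure_univ_lt_top
  filter_upwards [hc] with x hx
  exact (mul_eq_zero.1 (hx.trans hc0)).resolve_right (Real.exp_pos _).ne'

theorem IsPoissonSolution.ae_eq (hW : Integrable fun x => Real.exp (-(V + U) x))
    (hP : SatisfiesPoincare (gibbs (V + U))) {φ₁ g₁ φ₂ g₂ : ℝ → ℝ}
    (h₁ : IsPoissonSolution V U f φ₁ g₁) (h₂ : IsPoissonSolution V U f φ₂ g₂) :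
    φ₁ =ᵐ[volume] φ₂ ∧ g₁ =ᵐ[volume] g₂ := by
  have := isProbabilityMeasure_gibbs hW
  have hsub : MemH1 (gibbs (V + U)) (φ₁ - φ₂) (g₁ - g₂) := h₁.memH1.sub h₂.memH1
  have hgrad : g₁ - g₂ =ᵐ[volume] 0 := by
    refine ae_eq_zero_of_integral_mul_deriv_gibbs_eq_zero hW
      (hsub.memLp_deriv.integrable one_le_two) fun ψ hψ => ?_
    obtain ⟨C, hC⟩ := hψ.2.deriv.exists_bound_of_continuous (continuous_deriv_of_smoothCompact hψ)
    have hint : ∀ {g}, MemLp g 2 (gibbs (V + U)) →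
        Integrable (fun x => g x * deriv ψ x) (gibbs (V + U)) := fun hg =>
      (hg.integrable one_le_two).mul_bdd
        (continuous_deriv_of_smoothCompact hψ).aestronglyMeasurable (.of_forall hC)
    simp only [Pi.sub_apply, sub_mul]
    rw [integral_sub (hint h₁.memH1.memLp_deriv) (hint h₂.memH1.memLp_deriv), h₁.weak ψ hψ,
      h₂.weak ψ hψ, sub_self]
  have hvar : Var[φ₁ - φ₂; gibbs (V + U)] = 0 := by
    obtain ⟨C, -, hvar⟩ := satisfiesPoincare_iff_variance_le.1 hP
    refine le_antisymm ((hvar _ _ hsub).trans_eq ?_) (variance_nonneg _ _)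
    rw [integral_eq_zero_of_ae ?_, mul_zero]
    filter_upwards [(gibbs_absolutelyContinuous _).ae_le hgrad] with x hx
    simp [hx]
  have hmean : ∫ x, (φ₁ - φ₂) x ∂(gibbs (V + U)) = 0 := by
    rw [integral_sub' (h₁.memH1.memLp.integrable one_le_two)
      (h₂.memH1.memLp.integrable one_le_two), h₁.integral_eq_zero, h₂.integral_eq_zero, sub_self]
  refine ⟨(absolutelyContinuous_gibbs hW).ae_le ?_, sub_ae_eq_zero _ _ |>.1 hgrad⟩
  filter_upwards [ae_eq_integral_of_variance_eq_zero hsub.memLp hvar] with x hx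
  exact sub_eq_zero.1 (hx.trans hmean)

theorem poissonWellPosed (hV : Continuous V) (hVint : Integrable fun x => Real.exp (-V x))
    (hf : Continuous f) (hfint : Integrable f (gibbs V)) (hU : IsAdmissible V f U) :
    PoissonWellPosed V U f := by
  obtain ⟨φ, hφ⟩ := exists_isPoissonSolution hV hVint hf hfint hU
  exact ⟨φ, _, hφ, fun φ₁ g₁ h => h.ae_eq hU.integrable hU.poincare hφ⟩

theorem asymptoticVariance_eq (hV : Continuous V) (hVint : Integrable fun x => Real.exp (-V x))
    (hf : Continuous f) (hfint : Integrable f (gibbs V)) (hU : IsAdmissible V f U) :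
    asymptoticVariance V f U = 2 * partition (V + U) ^ 2 / partition V ^ 2 *
      ∫ x, poissonGradient V U f x ^ 2 ∂(gibbs (V + U)) := by
  obtain ⟨φ, hφ⟩ := exists_isPoissonSolution hV hVint hf hfint hU
  have h : ∃ p : (ℝ → ℝ) × (ℝ → ℝ), IsPoissonSolution V U f p.1 p.2 := ⟨(φ, _), hφ⟩
  have hae := ((Classical.choose_spec h).ae_eq hU.integrable hU.poincare hφ).2
  rw [asymptoticVariance, dif_pos h]
  congr 1
  refine integral_congr_ae ?_
  filter_upwards [(gibbs_absolutelyContinuous _).ae_le hae] with x hx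
  rw [hx, sq_abs]

end PoissonEquation

/-! ### Gaussian average of the asymptotic variance -/

section Sum

variable {ι : Type*} [Fintype ι] {V U : ℝ → ℝ} {f : ι → ℝ → ℝ}

theorem integrable_sum_mul {ν : Measure ℝ} (hf : ∀ j, Integrable (f j) ν) (c : ι → ℝ) :
    Integrable (fun x => ∑ j, c j * f j x) ν :=
  integrable_finsetSum _ fun j _ => (hf j).const_mul (c j)

theorem continuous_sum_mul (hf : ∀ j, Continuous (f j)) (c : ι → ℝ) :
    Continuous fun x => ∑ j, c j * f j x :=
  continuous_finsetSum _ fun j _ => continuous_const.mul (hf j)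

theorem mean_sum (hfint : ∀ j, Integrable (f j) (gibbs V)) (c : ι → ℝ) :
    mean V (fun x => ∑ j, c j * f j x) = ∑ j, c j * mean V (f j) := by
  simp only [mean, integral_finsetSum _ fun j _ => (hfint j).const_mul (c j), integral_const_mul]

theorem sum_sub_mean_mul (hfint : ∀ j, Integrable (f j) (gibbs V)) (c : ι → ℝ) (x a : ℝ) :
    (∑ j, c j * f j x - mean V fun x => ∑ j, c j * f j x) * a =
      ∑ j, c j * ((f j x - mean V (f j)) * a) := by
  rw [mean_sum hfint, ← Finset.sum_sub_distrib, Finset.sum_mul]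
  exact Finset.sum_congr rfl fun j _ => by ring

theorem flux_sum (hVint : Integrable fun x => Real.exp (-V x))
    (hfint : ∀ j, Integrable (f j) (gibbs V)) (c : ι → ℝ) (x : ℝ) :
    flux V (fun x => ∑ j, c j * f j x) x = ∑ j, c j * flux V (f j) x := by
  simp only [flux_eq_setIntegral hVint (hfint _),
    flux_eq_setIntegral hVint (integrable_sum_mul hfint c), sum_sub_mean_mul hfint,
    ← integral_const_mul]
  exact integral_finsetSum _ fun j _ =>
    ((integrable_flux_density hVint (hfint j)).const_mul (c j)).integrableOn

theorem poissonGradient_sum (hVint : Integrable fun x => Real.exp (-V x))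
    (hfint : ∀ j, Integrable (f j) (gibbs V)) (c : ι → ℝ) (x : ℝ) :
    poissonGradient V U (fun x => ∑ j, c j * f j x) x =
      ∑ j, c j * poissonGradient V U (f j) x := by
  simp only [poissonGradient, flux_sum hVint hfint, Finset.sum_mul, ← Finset.sum_neg_distrib,
    mul_assoc, mul_neg]

theorem isAdmissible_sum [Nonempty ι] (hfint : ∀ j, Integrable (f j) (gibbs V))
    (hU : ∀ j, IsAdmissible V (f j) U) (c : ι → ℝ) :
    IsAdmissible V (fun x => ∑ j, c j * f j x) U := by
  obtain ⟨i⟩ := ‹Nonempty ι›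
  refine ⟨(hU i).smooth, (hU i).integrable, (hU i).poincare, ?_, (hU i).strongSolution⟩
  simp only [sum_sub_mean_mul hfint]
  exact memLp_finsetSum _ fun j _ => (hU j).memLp.const_mul (c j)

end Sum

section Gaussian

variable {J : ℕ}

instance (J : ℕ) : IsProbabilityMeasure (stdGaussianPi J) := by
  unfold stdGaussianPi
  infer_instance

theorem memLp_eval_stdGaussianPi (i : Fin J) :
    MemLp (fun u : Fin J → ℝ => u i) 2 (stdGaussianPi J) :=
  (memLp_id_gaussianReal' 2 (by simp)).comp_measurePreserving
    (measurePreserving_eval (fun _ : Fin J => gaussianReal 0 1) i)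

theorem integrable_mul_stdGaussianPi (i j : Fin J) :
    Integrable (fun u : Fin J → ℝ => u i * u j) (stdGaussianPi J) :=
  (memLp_eval_stdGaussianPi i).integrable_mul (memLp_eval_stdGaussianPi j)

theorem integral_eval_stdGaussianPi (i : Fin J) : ∫ u, u i ∂(stdGaussianPi J) = 0 :=
  (integral_comp_eval (μ := fun _ : Fin J => gaussianReal 0 1) (i := i) (f := fun x : ℝ => x)
    aestronglyMeasurable_id).trans integral_id_gaussianReal

theorem integral_mul_stdGaussianPi (i j : Fin J) :
    ∫ u, u i * u j ∂(stdGaussianPi J) = if i = j then 1 else 0 := by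
  split_ifs with hij
  · subst hij
    simp only [← pow_two]
    calc ∫ u, u i ^ 2 ∂(stdGaussianPi J) = ∫ x, x ^ 2 ∂(gaussianReal 0 1) :=
          integral_comp_eval (μ := fun _ : Fin J => gaussianReal 0 1) (i := i)
            (f := fun x : ℝ => x ^ 2) (by fun_prop)
      _ = Var[fun x => x; gaussianReal 0 1] :=
          (variance_of_integral_eq_zero aemeasurable_id integral_id_gaussianReal).symm
      _ = 1 := variance_fun_id_gaussianReal
  · have hindep : iIndepFun (fun (i : Fin J) (u : Fin J → ℝ) => u i) (stdGaussianPi J) :=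
      iIndepFun_pi (X := fun _ x => x) fun _ => aemeasurable_id
    rw [(hindep.indepFun hij).integral_fun_mul_eq_mul_integral (memLp_eval_stdGaussianPi i).1
      (memLp_eval_stdGaussianPi j).1, integral_eval_stdGaussianPi, zero_mul]

theorem integrable_quadraticForm_stdGaussianPi (a : Fin J → Fin J → ℝ) :
    Integrable (fun u => ∑ i, ∑ j, a i j * (u i * u j)) (stdGaussianPi J) :=
  integrable_finsetSum _ fun i _ => integrable_finsetSum _ fun j _ =>
    (integrable_mul_stdGaussianPi i j).const_mul _

theorem integral_quadraticForm_stdGaussianPi (a : Fin J → Fin J → ℝ) :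
    ∫ u, ∑ i, ∑ j, a i j * (u i * u j) ∂(stdGaussianPi J) = ∑ i, a i i := by
  have hint := fun i j => (integrable_mul_stdGaussianPi i j).const_mul (a i j)
  rw [integral_finsetSum _ fun i _ => integrable_finsetSum _ fun j _ => hint i j]
  simp only [integral_finsetSum _ fun j _ => hint _ j, integral_const_mul,
    integral_mul_stdGaussianPi, mul_ite, mul_one, mul_zero, Finset.sum_ite_eq, Finset.mem_univ,
    if_true]

end Gaussian

section Average

variable {J : ℕ} {V U : ℝ → ℝ} {lam : Fin J → ℝ} {f : Fin J → ℝ → ℝ}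

theorem poissonWellPosed_randomObservable [NeZero J] (hV : Continuous V)
    (hVint : Integrable fun x => Real.exp (-V x)) (hf : ∀ j, Continuous (f j))
    (hfint : ∀ j, Integrable (f j) (gibbs V)) (hU : U ∈ admissible V f) (u : Fin J → ℝ) :
    PoissonWellPosed V U (randomObservable lam f u) :=
  poissonWellPosed hV hVint (continuous_sum_mul hf _) (integrable_sum_mul hfint _)
    (isAdmissible_sum hfint hU _)

theorem asymptoticVariance_randomObservable [NeZero J] (hV : Continuous V)
    (hVint : Integrable fun x => Real.exp (-V x)) (hf : ∀ j, Continuous (f j))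
    (hfint : ∀ j, Integrable (f j) (gibbs V)) (hU : U ∈ admissible V f) (u : Fin J → ℝ) :
    asymptoticVariance V (randomObservable lam f u) U =
      ∑ i, ∑ j, (2 * partition (V + U) ^ 2 / partition V ^ 2 * (√(lam i) * √(lam j) *
        ∫ x, poissonGradient V U (f i) x * poissonGradient V U (f j) x ∂(gibbs (V + U)))) *
          (u i * u j) := by
  have hmul : ∀ i j, Integrable (fun x => poissonGradient V U (f i) x *
      poissonGradient V U (f j) x) (gibbs (V + U)) := fun i j =>
    (memLp_poissonGradient hV hVint (hf i) (hfint i) (hU i)).integrable_mul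
      (memLp_poissonGradient hV hVint (hf j) (hfint j) (hU j))
  have hsq : ∀ x, poissonGradient V U (randomObservable lam f u) x ^ 2 =
      ∑ i, ∑ j, (√(lam i) * u i * (√(lam j) * u j)) *
        (poissonGradient V U (f i) x * poissonGradient V U (f j) x) := fun x => by
    unfold randomObservable
    rw [poissonGradient_sum hVint hfint, pow_two, Finset.sum_mul_sum]
    simp only [mul_mul_mul_comm]
  have hvar := asymptoticVariance_eq (f := randomObservable lam f u) hV hVint
    (continuous_sum_mul hf _) (integrable_sum_mul hfint _) (isAdmissible_sum hfint hU _)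
  simp only [hvar, hsq]
  rw [integral_finsetSum _ fun i _ => integrable_finsetSum _ fun j _ => (hmul i j).const_mul _]
  simp only [integral_finsetSum _ fun j _ => (hmul _ j).const_mul _, integral_const_mul,
    Finset.mul_sum]
  exact Finset.sum_congr rfl fun i _ => Finset.sum_congr rfl fun j _ => by ring

theorem integrable_asymptoticVariance [NeZero J] (hV : Continuous V)
    (hVint : Integrable fun x => Real.exp (-V x)) (hf : ∀ j, Continuous (f j))
    (hfint : ∀ j, Integrable (f j) (gibbs V)) (hU : U ∈ admissible V f) :
    Integrable (fun u => asymptoticVariance V (randomObservable lam f u) U)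
      (stdGaussianPi J) := by
  simp only [asymptoticVariance_randomObservable hV hVint hf hfint hU]
  exact integrable_quadraticForm_stdGaussianPi _

theorem averagedVariance_eq_sum [NeZero J] (hV : Continuous V)
    (hVint : Integrable fun x => Real.exp (-V x)) (hlam : ∀ j, 0 ≤ lam j)
    (hf : ∀ j, Continuous (f j)) (hfint : ∀ j, Integrable (f j) (gibbs V))
    (hU : U ∈ admissible V f) :
    averagedVariance V lam f U = ∑ j, lam j * asymptoticVariance V (f j) U := by
  simp only [averagedVariance, asymptoticVariance_randomObservable hV hVint hf hfint hU]
  rw [integral_quadraticForm_stdGaussianPi]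
  refine Finset.sum_congr rfl fun j _ => ?_
  rw [asymptoticVariance_eq hV hVint (hf j) (hfint j) (hU j), Real.mul_self_sqrt (hlam j)]
  simp only [← pow_two]
  ring

theorem sq_optimalDensity (hlam : ∀ j, 0 ≤ lam j) (x : ℝ) :
    optimalDensity V lam f x ^ 2 = ∑ j, lam j * flux V (f j) x ^ 2 := by
  have hnonneg : ∀ j, 0 ≤ lam j * |primitiveF V (f j) x - constA V (f j)| ^ 2 := fun j =>
    mul_nonneg (hlam j) (by positivity)
  rw [optimalDensity, Real.sq_sqrt (Finset.sum_nonneg fun j _ => hnonneg j)]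
  simp only [sq_abs, flux]

theorem sq_optimalDensity_mul_exp (hlam : ∀ j, 0 ≤ lam j) (x : ℝ) :
    (optimalDensity V lam f x * Real.exp ((V + U) x)) ^ 2 =
      ∑ j, lam j * poissonGradient V U (f j) x ^ 2 := by
  simp only [mul_pow, sq_optimalDensity hlam, poissonGradient, neg_sq, Finset.sum_mul, mul_assoc]

theorem continuous_optimalDensity (hV : Continuous V) (hf : ∀ j, Continuous (f j)) :
    Continuous (optimalDensity V lam f) :=
  (continuous_finsetSum _ fun j _ =>
    continuous_const.mul ((continuous_flux hV (hf j)).abs.pow 2)).sqrt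

theorem memLp_optimalDensity_mul_exp [NeZero J] (hV : Continuous V)
    (hVint : Integrable fun x => Real.exp (-V x)) (hlam : ∀ j, 0 ≤ lam j)
    (hf : ∀ j, Continuous (f j)) (hfint : ∀ j, Integrable (f j) (gibbs V))
    (hU : U ∈ admissible V f) :
    MemLp (fun x => optimalDensity V lam f x * Real.exp ((V + U) x)) 2 (gibbs (V + U)) := by
  have hcont : Continuous fun x => optimalDensity V lam f x * Real.exp ((V + U) x) :=
    (continuous_optimalDensity hV hf).mul (hV.add (hU 0).smooth.continuous).rexp
  rw [memLp_two_iff_integrable_sq hcont.aestronglyMeasurable]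
  simp only [sq_optimalDensity_mul_exp hlam]
  exact integrable_finsetSum _ fun j _ =>
    (memLp_poissonGradient hV hVint (hf j) (hfint j) (hU j)).integrable_sq.const_mul _

theorem averagedVariance_eq_integral [NeZero J] (hV : Continuous V)
    (hVint : Integrable fun x => Real.exp (-V x)) (hlam : ∀ j, 0 ≤ lam j)
    (hf : ∀ j, Continuous (f j)) (hfint : ∀ j, Integrable (f j) (gibbs V))
    (hU : U ∈ admissible V f) :
    averagedVariance V lam f U = 2 * partition (V + U) ^ 2 / partition V ^ 2 *
      ∫ x, (optimalDensity V lam f x * Real.exp ((V + U) x)) ^ 2 ∂(gibbs (V + U)) := by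
  have hint : ∀ j, Integrable (fun x => lam j * poissonGradient V U (f j) x ^ 2)
      (gibbs (V + U)) := fun j =>
    (memLp_poissonGradient hV hVint (hf j) (hfint j) (hU j)).integrable_sq.const_mul _
  simp only [sq_optimalDensity_mul_exp hlam]
  rw [averagedVariance_eq_sum hV hVint hlam hf hfint hU, integral_finsetSum _ fun j _ => hint j,
    Finset.mul_sum]
  refine Finset.sum_congr rfl fun j _ => ?_
  rw [asymptoticVariance_eq hV hVint (hf j) (hfint j) (hU j), integral_const_mul, mul_left_comm]

end Average

/-! ### Optimization of the biasing potential -/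

/-- The functional `W ↦ (∫ exp (-W)) (∫ s² exp W)`. Up to a constant factor, the averaged variance
for the biasing potential `U` is its value at `W = V + U` when `s` is `optimalDensity`. -/
noncomputable def biasingCost (s W : ℝ → ℝ) : ℝ := partition W * ∫ x, s x ^ 2 * Real.exp (W x)

section LowerBound

variable {s W : ℝ → ℝ}

theorem mul_exp_mul_exp_neg (a t : ℝ) : a * Real.exp t * Real.exp (-t) = a := by
  rw [mul_assoc, ← Real.exp_add, add_neg_cancel, Real.exp_zero, mul_one]

theorem sq_mul_exp_mul_exp_neg (a t : ℝ) :
    (a * Real.exp t) ^ 2 * Real.exp (-t) = a ^ 2 * Real.exp t := by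
  rw [mul_pow, pow_two (Real.exp t), ← mul_assoc, mul_exp_mul_exp_neg]

theorem integral_sq_mul_exp_gibbs (s W : ℝ → ℝ) :
    ∫ x, (s x * Real.exp (W x)) ^ 2 ∂(gibbs W) =
      (∫ x, s x ^ 2 * Real.exp (W x)) / partition W := by
  simp only [integral_gibbs, sq_mul_exp_mul_exp_neg]

theorem integrable_sq_mul_exp (hW : Integrable fun x => Real.exp (-W x))
    (hs : MemLp (fun x => s x * Real.exp (W x)) 2 (gibbs W)) :
    Integrable fun x => s x ^ 2 * Real.exp (W x) := by
  simpa only [sq_mul_exp_mul_exp_neg] using (integrable_gibbs_iff hW _).1 hs.integrable_sq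

theorem integrable_of_memLp_mul_exp (hW : Integrable fun x => Real.exp (-W x))
    (hs : MemLp (fun x => s x * Real.exp (W x)) 2 (gibbs W)) : Integrable s := by
  have := isProbabilityMeasure_gibbs hW
  simpa only [mul_exp_mul_exp_neg] using
    (integrable_gibbs_iff hW _).1 (hs.integrable one_le_two)

theorem sq_integral_le_biasingCost (hW : Integrable fun x => Real.exp (-W x))
    (hs : MemLp (fun x => s x * Real.exp (W x)) 2 (gibbs W)) :
    (∫ x, s x) ^ 2 ≤ biasingCost s W := by
  have := isProbabilityMeasure_gibbs hW
  have hZ := partition_pos hW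
  have hvar := variance_nonneg (fun x => s x * Real.exp (W x)) (gibbs W)
  rw [variance_eq_sub hs, sub_nonneg] at hvar
  simp only [Pi.pow_apply, integral_sq_mul_exp_gibbs] at hvar
  simp only [integral_gibbs, mul_exp_mul_exp_neg, div_pow] at hvar
  rwa [div_le_div_iff₀ (by positivity) hZ, pow_two (partition W), ← mul_assoc,
    mul_le_mul_iff_left₀ hZ, mul_comm] at hvar

end LowerBound

section Cutoff

variable {V s q G : ℝ → ℝ}

theorem exp_mul_log_le {χ q : ℝ} (hχ : χ ∈ Icc (0 : ℝ) 1) (hq : 0 < q) :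
    Real.exp (χ * Real.log q) ≤ 1 + q := by
  calc Real.exp (χ * Real.log q) = q ^ χ := by rw [Real.rpow_def_of_pos hq, mul_comm]
    _ ≤ 1 + χ * (q - 1) := by
        simpa only [add_sub_cancel] using
          rpow_one_add_le_one_add_mul_self (by linarith : -1 ≤ q - 1) hχ.1 hχ.2
    _ ≤ 1 + q := by nlinarith [hχ.1, hχ.2]

theorem tendsto_integral_mul_exp_cutoff_mul_log (hG : Integrable G)
    (hGq : Integrable fun x => G x * q x) (hq : Measurable q) (hq0 : ∀ x, 0 < q x) :
    Tendsto (fun n => ∫ x, G x * Real.exp (cutoff n x * Real.log (q x))) atTop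
      (𝓝 (∫ x, G x * q x)) := by
  have hbound : Integrable fun x => ‖G x‖ + ‖G x * q x‖ := hG.norm.add hGq.norm
  refine tendsto_integral_of_dominated_convergence _ (fun n => hG.1.mul ?_) hbound
    (fun n => .of_forall fun x => ?_) (.of_forall fun x => ?_)
  · exact ((cutoff n).continuous.measurable.mul hq.log).exp.aestronglyMeasurable
  · rw [norm_mul, norm_mul, Real.norm_of_nonneg (Real.exp_pos _).le,
      Real.norm_of_nonneg (hq0 x).le, ← mul_one_add]
    gcongr
    exact exp_mul_log_le ⟨(cutoff n).nonneg, (cutoff n).le_one⟩ (hq0 x)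
  · refine tendsto_const_nhds.congr' ?_
    filter_upwards [eventually_cutoff_eq_one |x|] with n hn
    rw [hn x le_rfl, one_mul, Real.exp_log (hq0 x)]

theorem neg_cutoff_mul_log_mem_smoothCompact (hq : ContDiff ℝ ∞ q) (hq0 : ∀ x, 0 < q x) (n : ℕ) :
    (fun x => -(cutoff n x * Real.log (q x))) ∈ smoothCompact :=
  ⟨((cutoff n).contDiff.mul (hq.log fun x => (hq0 x).ne')).neg,
    (cutoff n).hasCompactSupport.mul_right.neg⟩

/-- The potentials `-χ log q`, for cutoffs `χ` tending to `1`, approach the cost of the sampling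
density `q exp (-V)`. -/
theorem tendsto_biasingCost_cutoff (hVint : Integrable fun x => Real.exp (-V x))
    (hsV : Integrable fun x => s x ^ 2 * Real.exp (V x)) (hq : Measurable q) (hq0 : ∀ x, 0 < q x)
    (hVq : Integrable fun x => Real.exp (-V x) * q x)
    (hsq : Integrable fun x => s x ^ 2 * Real.exp (V x) * (q x)⁻¹) :
    Tendsto (fun n => biasingCost s (V + fun x => -(cutoff n x * Real.log (q x)))) atTop
      (𝓝 ((∫ x, Real.exp (-V x) * q x) * ∫ x, s x ^ 2 * Real.exp (V x) * (q x)⁻¹)) := by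
  convert (tendsto_integral_mul_exp_cutoff_mul_log hVint hVq hq hq0).mul
    (tendsto_integral_mul_exp_cutoff_mul_log hsV hsq hq.inv fun x => inv_pos.2 (hq0 x)) using 2
    with n
  simp only [biasingCost, partition, Pi.add_apply, neg_add, neg_neg, Real.exp_add, mul_assoc,
    Real.log_inv, mul_neg]

end Cutoff

section UpperBound

variable {V s : ℝ → ℝ}

theorem exists_contDiff_between {a : ℝ → ℝ} (ha : ContDiff ℝ ∞ fun x => a x ^ 2)
    (ha0 : ∀ x, 0 ≤ a x) {ε : ℝ} (hε : 0 < ε) :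
    ∃ q : ℝ → ℝ, ContDiff ℝ ∞ q ∧ ∀ x, 0 < q x ∧ a x ≤ q x ∧ q x ≤ a x + ε := by
  have hpos : ∀ x, 0 < a x ^ 2 + ε ^ 2 := fun x => by positivity
  refine ⟨fun x => √(a x ^ 2 + ε ^ 2), (ha.add contDiff_const).sqrt fun x => (hpos x).ne',
    fun x => ⟨Real.sqrt_pos.2 (hpos x), Real.le_sqrt_of_sq_le ?_, Real.sqrt_le_iff.2 ⟨?_, ?_⟩⟩⟩
  · linarith [sq_nonneg ε]
  · linarith [ha0 x]
  · nlinarith [mul_nonneg (ha0 x) hε.le]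

theorem le_integral_add_mul_integral (hV : ContDiff ℝ ∞ V) (hs : ContDiff ℝ ∞ fun x => s x ^ 2)
    (hs0 : ∀ x, 0 ≤ s x) (hVint : Integrable fun x => Real.exp (-V x)) (hsint : Integrable s)
    (hsV : Integrable fun x => s x ^ 2 * Real.exp (V x)) {c : ℝ}
    (hc : ∀ U ∈ smoothCompact, c ≤ biasingCost s (V + U)) {ε : ℝ} (hε : 0 < ε) :
    c ≤ ((∫ x, s x) + ε * partition V) * ∫ x, s x := by
  obtain ⟨q, hq, hbetween⟩ := exists_contDiff_between (a := fun x => s x * Real.exp (V x))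
    (by simpa only [mul_pow] using hs.mul (hV.exp.pow 2))
    (fun x => mul_nonneg (hs0 x) (Real.exp_pos _).le) hε
  choose hq0 hle hge using hbetween
  have hupper : ∀ x, Real.exp (-V x) * q x ≤ s x + ε * Real.exp (-V x) := fun x => by
    calc Real.exp (-V x) * q x ≤ Real.exp (-V x) * (s x * Real.exp (V x) + ε) := by
          gcongr; exact hge x
      _ = s x * Real.exp (V x) * Real.exp (-V x) + ε * Real.exp (-V x) := by ring
      _ = s x + ε * Real.exp (-V x) := by rw [mul_exp_mul_exp_neg]
  have hlower : ∀ x, s x ^ 2 * Real.exp (V x) * (q x)⁻¹ ≤ s x := fun x => by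
    rw [mul_inv_le_iff₀ (hq0 x), pow_two, mul_assoc]
    exact mul_le_mul_of_nonneg_left (hle x) (hs0 x)
  have hupper0 : ∀ x, 0 ≤ Real.exp (-V x) * q x := fun x =>
    mul_nonneg (Real.exp_pos _).le (hq0 x).le
  have hlower0 : ∀ x, 0 ≤ s x ^ 2 * Real.exp (V x) * (q x)⁻¹ := fun x =>
    mul_nonneg (by positivity) (inv_pos.2 (hq0 x)).le
  have hbound := hsint.add (hVint.const_mul ε)
  have hVq : Integrable fun x => Real.exp (-V x) * q x :=
    hbound.mono' (hVint.1.mul hq.continuous.aestronglyMeasurable) (.of_forall fun x =>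
      (Real.norm_of_nonneg (hupper0 x)).trans_le (hupper x))
  have hsq : Integrable fun x => s x ^ 2 * Real.exp (V x) * (q x)⁻¹ :=
    hsint.mono' (hsV.1.mul hq.continuous.measurable.inv.aestronglyMeasurable)
      (.of_forall fun x => (Real.norm_of_nonneg (hlower0 x)).trans_le (hlower x))
  calc c ≤ (∫ x, Real.exp (-V x) * q x) * ∫ x, s x ^ 2 * Real.exp (V x) * (q x)⁻¹ :=
        ge_of_tendsto' (tendsto_biasingCost_cutoff hVint hsV hq.continuous.measurable hq0 hVq hsq)
          fun n => hc _ (neg_cutoff_mul_log_mem_smoothCompact hq hq0 n)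
    _ ≤ (∫ x, s x + ε * Real.exp (-V x)) * ∫ x, s x :=
        mul_le_mul (integral_mono hVq hbound hupper) (integral_mono hsq hsint hlower)
          (integral_nonneg hlower0) ((integral_nonneg hupper0).trans
            (integral_mono hVq hbound hupper))
    _ = ((∫ x, s x) + ε * partition V) * ∫ x, s x := by
        rw [integral_add hsint (hVint.const_mul ε), integral_const_mul, partition]

theorem le_sq_integral_of_forall_le_biasingCost (hV : ContDiff ℝ ∞ V)
    (hs : ContDiff ℝ ∞ fun x => s x ^ 2) (hs0 : ∀ x, 0 ≤ s x)
    (hVint : Integrable fun x => Real.exp (-V x)) (hsint : Integrable s)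
    (hsV : Integrable fun x => s x ^ 2 * Real.exp (V x)) {c : ℝ}
    (hc : ∀ U ∈ smoothCompact, c ≤ biasingCost s (V + U)) : c ≤ (∫ x, s x) ^ 2 := by
  have hlim : Tendsto (fun ε : ℝ => ((∫ x, s x) + ε * partition V) * ∫ x, s x) (𝓝[>] 0)
      (𝓝 (((∫ x, s x) + 0 * partition V) * ∫ x, s x)) :=
    tendsto_nhdsWithin_of_tendsto_nhds (Continuous.tendsto (by fun_prop) 0)
  rw [zero_mul, add_zero, ← pow_two] at hlim
  exact ge_of_tendsto hlim (eventually_mem_nhdsWithin.mono fun ε hε =>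
    le_integral_add_mul_integral hV hs hs0 hVint hsint hsV hc hε)

end UpperBound

section OptimalDensity

variable {J : ℕ} {V U : ℝ → ℝ} {lam : Fin J → ℝ} {f : Fin J → ℝ → ℝ}

theorem contDiff_flux {f : ℝ → ℝ} (hV : ContDiff ℝ ∞ V) (hf : ContDiff ℝ ∞ f) :
    ContDiff ℝ ∞ (flux V f) := by
  have hderiv := hasDerivAt_flux hV.continuous hf.continuous
  rw [contDiff_infty_iff_deriv, funext fun x => (hderiv x).deriv]
  exact ⟨fun x => (hderiv x).differentiableAt, (hf.sub contDiff_const).mul hV.neg.exp⟩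

theorem contDiff_sq_optimalDensity (hV : ContDiff ℝ ∞ V) (hlam : ∀ j, 0 ≤ lam j)
    (hf : ∀ j, ContDiff ℝ ∞ (f j)) : ContDiff ℝ ∞ fun x => optimalDensity V lam f x ^ 2 := by
  simp only [sq_optimalDensity hlam]
  exact .sum fun j _ => contDiff_const.mul ((contDiff_flux hV (hf j)).pow 2)

theorem averagedVariance_eq_biasingCost [NeZero J] (hV : Continuous V)
    (hVint : Integrable fun x => Real.exp (-V x)) (hlam : ∀ j, 0 ≤ lam j)
    (hf : ∀ j, Continuous (f j)) (hfint : ∀ j, Integrable (f j) (gibbs V))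
    (hU : U ∈ admissible V f) : averagedVariance V lam f U =
      2 / partition V ^ 2 * biasingCost (optimalDensity V lam f) (V + U) := by
  have hZ := partition_pos (hU 0).integrable
  rw [averagedVariance_eq_integral hV hVint hlam hf hfint hU, integral_sq_mul_exp_gibbs,
    biasingCost]
  field_simp

theorem integrable_optimalDensity [NeZero J] (hV : Continuous V)
    (hVint : Integrable fun x => Real.exp (-V x)) (hlam : ∀ j, 0 ≤ lam j)
    (hf : ∀ j, Continuous (f j)) (hfint : ∀ j, Integrable (f j) (gibbs V))
    (hU : U ∈ admissible V f) : Integrable (optimalDensity V lam f) :=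
  integrable_of_memLp_mul_exp (hU 0).integrable
    (memLp_optimalDensity_mul_exp hV hVint hlam hf hfint hU)

theorem sq_integral_optimalDensity_le_averagedVariance [NeZero J] (hV : Continuous V)
    (hVint : Integrable fun x => Real.exp (-V x)) (hlam : ∀ j, 0 ≤ lam j)
    (hf : ∀ j, Continuous (f j)) (hfint : ∀ j, Integrable (f j) (gibbs V))
    (hU : U ∈ admissible V f) :
    2 / partition V ^ 2 * (∫ x, optimalDensity V lam f x) ^ 2 ≤ averagedVariance V lam f U := by
  rw [averagedVariance_eq_biasingCost hV hVint hlam hf hfint hU]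
  gcongr
  exact sq_integral_le_biasingCost (hU 0).integrable
    (memLp_optimalDensity_mul_exp hV hVint hlam hf hfint hU)

theorem isGLB_averagedVariance_smoothCompact [NeZero J] (hV : ContDiff ℝ ∞ V)
    (hlam : ∀ j, 0 ≤ lam j) (hf : ∀ j, ContDiff ℝ ∞ (f j))
    (hfint : ∀ j, Integrable (f j) (gibbs V)) (h0 : (0 : ℝ → ℝ) ∈ admissible V f) :
    IsGLB (averagedVariance V lam f '' smoothCompact)
      (2 / partition V ^ 2 * (∫ x, optimalDensity V lam f x) ^ 2) := by
  have hVint := (h0 0).integrable_exp_neg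
  have hsub := smoothCompact_subset_admissible hV h0
  have hfc := fun j => (hf j).continuous
  have hmem : MemLp (fun x => optimalDensity V lam f x * Real.exp (V x)) 2 (gibbs V) := by
    simpa using memLp_optimalDensity_mul_exp hV.continuous hVint hlam hfc hfint h0
  have hZ : 0 < 2 / partition V ^ 2 := div_pos two_pos (pow_pos (partition_pos hVint) 2)
  refine ⟨?_, fun c hc => ?_⟩
  · rintro _ ⟨U, hU, rfl⟩
    exact sq_integral_optimalDensity_le_averagedVariance hV.continuous hVint hlam hfc hfint
      (hsub hU)
  · rw [← div_le_iff₀' hZ]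
    refine le_sq_integral_of_forall_le_biasingCost hV (contDiff_sq_optimalDensity hV hlam hf)
      (fun x => Real.sqrt_nonneg _) hVint (integrable_of_memLp_mul_exp hVint hmem)
      (integrable_sq_mul_exp hVint hmem) fun U hU => ?_
    rw [div_le_iff₀' hZ,
      ← averagedVariance_eq_biasingCost hV.continuous hVint hlam hfc hfint (hsub hU)]
    exact hc ⟨U, hU, rfl⟩

theorem isGLB_averagedVariance_admissible [NeZero J] (hV : ContDiff ℝ ∞ V)
    (hlam : ∀ j, 0 ≤ lam j) (hf : ∀ j, ContDiff ℝ ∞ (f j))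
    (hfint : ∀ j, Integrable (f j) (gibbs V)) (h0 : (0 : ℝ → ℝ) ∈ admissible V f) :
    IsGLB (averagedVariance V lam f '' admissible V f)
      (2 / partition V ^ 2 * (∫ x, optimalDensity V lam f x) ^ 2) := by
  refine ⟨?_, fun c hc => (isGLB_averagedVariance_smoothCompact hV hlam hf hfint h0).2
    (lowerBounds_mono_set (image_mono (smoothCompact_subset_admissible hV h0)) hc)⟩
  rintro _ ⟨U, hU, rfl⟩
  exact sq_integral_optimalDensity_le_averagedVariance hV.continuous (h0 0).integrable_exp_neg
    hlam (fun j => (hf j).continuous) hfint hU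

end OptimalDensity

end BiasedLangevin

theorem mainTheorem9 (J : ℕ) (hJ : 0 < J) (V : ℝ → ℝ) (lam : Fin J → ℝ) (f : Fin J → ℝ → ℝ)
    (hV : ContDiff ℝ ∞ V) (hVint : Integrable fun x => Real.exp (-V x))
    (hlam : ∀ j, 0 < lam j)
    (hf : ∀ j, ContDiff ℝ ∞ (f j))
    (hfint : ∀ j, Integrable (f j) (BiasedLangevin.gibbs V))
    (hfconst : ∀ j, ¬ ∃ c : ℝ, ∀ᵐ x ∂(BiasedLangevin.gibbs V), f j x = c)
    (h0 : (0 : ℝ → ℝ) ∈ BiasedLangevin.admissible V f) :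
    BiasedLangevin.smoothCompact ⊆ BiasedLangevin.admissible V f ∧
    (∀ U ∈ BiasedLangevin.admissible V f,
      (∀ j, BiasedLangevin.PoissonWellPosed V U (f j)) ∧
      (∀ u : Fin J → ℝ,
        BiasedLangevin.PoissonWellPosed V U (BiasedLangevin.randomObservable lam f u)) ∧
      Integrable (fun u => BiasedLangevin.asymptoticVariance V
        (BiasedLangevin.randomObservable lam f u) U) (BiasedLangevin.stdGaussianPi J) ∧
      BiasedLangevin.averagedVariance V lam f U =
        ∑ j, lam j * BiasedLangevin.asymptoticVariance V (f j) U) ∧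
    Integrable (BiasedLangevin.optimalDensity V lam f) ∧
    IsGLB (BiasedLangevin.averagedVariance V lam f '' BiasedLangevin.admissible V f)
      (2 / BiasedLangevin.partition V ^ 2 *
        (∫ x, BiasedLangevin.optimalDensity V lam f x) ^ 2) ∧
    IsGLB (BiasedLangevin.averagedVariance V lam f '' BiasedLangevin.smoothCompact)
      (2 / BiasedLangevin.partition V ^ 2 *
        (∫ x, BiasedLangevin.optimalDensity V lam f x) ^ 2) := by
  open BiasedLangevin in
  have : NeZero J := ⟨hJ.ne'⟩
  have hVc := hV.continuous
  have hfc := fun j => (hf j).continuous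
  have hlam0 := fun j => (hlam j).le
  exact ⟨smoothCompact_subset_admissible hV h0,
    fun U hU =>
      ⟨fun j => poissonWellPosed hVc hVint (hfc j) (hfint j) (hU j),
        poissonWellPosed_randomObservable hVc hVint hfc hfint hU,
        integrable_asymptoticVariance hVc hVint hfc hfint hU,
        averagedVariance_eq_sum hVc hVint hlam0 hfc hfint hU⟩,
    integrable_optimalDensity hVc hVint hlam0 hfc hfint h0,
    isGLB_averagedVariance_admissible hV hlam0 hf hfint h0,
    isGLB_averagedVariance_smoothCompact hV hlam0 hf hfint h0⟩
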